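/- **Setting (online knapsack with a bursty adversary plus random order).** Let $n,\ell\in\mathbb N$ and $k,\Gamma\in\mathbb R$ with $80\le k\le n/2$, $|\ell-\frac{n\ln k}{k}|<1$ (that is, $\ell$ is $\frac{n\ln k}{k}$ rounded up or down to an integer), $\Gamma\ge\sqrt k$ and $\frac{\Gamma\ell}{n}\le\frac12$. The times $[n]=\{1,\dots,n\}$ are partitioned into the windows $\{1,\dots,\ell\},\{\ell+1,\dots,2\ell\},\dots$ (the last one possibly shorter). An adversary chooses a set $RO\subseteq[n]$ such that $[n]\setminus RO$ is covered by at most $\Gamma$ windows, and items $(v_i,w_i)$, $1\le i\le|RO|$, with values $v_i\ge0$ and sizes $w_i\in[0,1]$. These items are assigned to the times in $RO$ by a uniformly random bijection $I$. At each time outside $RO$ the adversary presents an arbitrary item with value $\ge 0$ and size in $[0,1]$, which may depend on $I$ and on the behaviour (and internal randomness) of the algorithm. Let $V_t,W_t$ be the value and size of the item at time $t$. An online algorithm knows $n,k,\ell,\Gamma$ (but not $RO$) and decides irrevocably at each time $t$ whether to select the item, $X^{alg}_t\in\{0,1\}$, knowing only the items at times $1,\dots,t$. Let $\mathrm{OPT}_{RO}=\max\{\sum_i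 v_ix_i:\sum_i w_ix_i\le k,\ x\in[0,1]^{|RO|}\}$. **Primal algorithm.** Let $a_4>0$ be a constant. At time $t$ compute an optimal solution $X^t$ (by any rule that uses only the items seen so far) of the linear program: maximize $\sum_{t'\le t}V_{t'}X_{t'}$ over $X\in[0,1]^t$ subject to $\sum_{t'\le t}W_{t'}X_{t'}\le(1-\frac{4\Gamma\ell}{t})\frac tn k$ and $\sum_{t'\in B,\,t'\le t}W_{t'}X_{t'}\le 601\,\frac{\ell}{n}k$ for every window $B$. Select the item at time $t$ if and only if the program is feasible, $X^t_t>0$, the total size selected before time $t$ is at most $k-1$, and the total size selected before time $t$ within the window of $t$ is at most $a_4\frac{\ell}{n}k-1$. **Theorem.** There is a constant $a_0$ such that for every constant $a_4\ge a_0$ there is a constant $C>0$ (depending only on $a_4$) such that, for all $n,\ell,k,\Gamma$ as above: 1. The primal algorithm always returns a feasible solution, $\sum_{t\le n}W_tX^{alg}_t\le k$. If no two random-order items of positive size have the same value density $v_i/w_i$, then $$\mathbb E\Big[\sum_{t\in RO}V_tX^{alg}_t\Big]\ge\Big(1-C\,\frac{\Gamma\ell}{n}\ln\frac{n}{\Gamma\ell}\Big)\mathrm{OPT}_{RO}\quad\text{and}\quad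 \mathbb E\Big[\sum_{t\in RO}V_tX^{alg}_t\Big]\ge\Big(1-C\,\frac{\Gamma\ln k}{k}\ln\frac{k}{\Gamma\ln k}\Big)\mathrm{OPT}_{RO}.$$ 2. There is a randomized online algorithm whose solution is always feasible and which satisfies both inequalities of part 1 for all instances, with no condition on the value densities. -/

import Mathlib

open scoped BigOperators

noncomputable section

namespace BARO

/-- An item of the knapsack problem. -/
structure Item where
  value : ℝ
  size : ℝ

/-- Admissible items: nonnegative value and size in `[0, 1]`. -/
def Item.Valid (x : Item) : Prop :=
  0 ≤ x.value ∧ 0 ≤ x.size ∧ x.size ≤ 1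

/-- Time steps are `Fin n`; the element `t : Fin n` is the `(t + 1)`-st time step. The windows
`{1, …, ℓ}, {ℓ + 1, …, 2ℓ}, …` are numbered `0, 1, …`; this is the number of the window of `t`. -/
def window (ℓ : ℕ) {n : ℕ} (t : Fin n) : ℕ := (t : ℕ) / ℓ

/-- A (deterministic) online algorithm: from the sequence of items it determines the set of times
whose items are selected, and whether `t` is selected depends only on the items up to `t`. -/
structure OnlineAlg (n : ℕ) where
  select : (Fin n → Item) → Finset (Fin n)
  online : ∀ (x y : Fin n → Item) (t : Fin n), (∀ s ≤ t, x s = y s) →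
    (t ∈ select x ↔ t ∈ select y)

/-- The selections fit the knapsack of size `k`, on every sequence of admissible items. -/
def OnlineAlg.Feasible {n : ℕ} (A : OnlineAlg n) (k : ℝ) : Prop :=
  ∀ x : Fin n → Item, (∀ t, (x t).Valid) → ∑ t ∈ A.select x, (x t).size ≤ k

/-! ### The linear programs and the algorithm -/

/-- Feasible solutions of the linear program at time `t`. The program has one variable for each
time up to `t`; the remaining coordinates are set to `0`. -/
structure LPFeasible {n : ℕ} (ℓ : ℕ) (k Γ : ℝ) (x : Fin n → Item) (t : Fin n) (X : Fin n → ℝ) :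
    Prop where
  nonneg : ∀ s, 0 ≤ X s
  le_one : ∀ s, X s ≤ 1
  future : ∀ s, t < s → X s = 0
  budget : ∑ s ∈ Finset.Iic t, (x s).size * X s ≤
    (1 - 4 * Γ * ℓ / ((t : ℝ) + 1)) * (((t : ℝ) + 1) / n) * k
  inner : ∀ j : ℕ, ∑ s ∈ Finset.Iic t with window ℓ s = j, (x s).size * X s ≤ 601 * (ℓ / n) * k

/-- Optimal solutions of the linear program at time `t`. -/
def LPOptimal {n : ℕ} (ℓ : ℕ) (k Γ : ℝ) (x : Fin n → Item) (t : Fin n) (X : Fin n → ℝ) : Prop :=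
  LPFeasible ℓ k Γ x t X ∧ ∀ Y, LPFeasible ℓ k Γ x t Y →
    ∑ s ∈ Finset.Iic t, (x s).value * Y s ≤ ∑ s ∈ Finset.Iic t, (x s).value * X s

/-- A rule that, from the items up to time `t`, computes an optimal solution of the linear program
at time `t` whenever this program has a feasible solution. -/
structure LPSolver (n ℓ : ℕ) (k Γ : ℝ) where
  sol : (Fin n → Item) → Fin n → Fin n → ℝ
  optimal : ∀ x t, (∃ X, LPFeasible ℓ k Γ x t X) → LPOptimal ℓ k Γ x t (sol x t)
  online : ∀ (x y : Fin n → Item) (t : Fin n), (∀ s ≤ t, x s = y s) → sol x t = sol y t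

/-- The item at time `t` is tentatively picked: the computed optimal solution of the linear program
at time `t` is positive at `t`. (Nothing is picked if the program is infeasible, which can only
happen while its budget is negative.) -/
def Tentative {n ℓ : ℕ} {k Γ : ℝ} (S : LPSolver n ℓ k Γ) (x : Fin n → Item) (t : Fin n) : Prop :=
  (∃ X, LPFeasible ℓ k Γ x t X) ∧ 0 < S.sol x t t

/-- The item at time `t` is picked, when `A` is the set of earlier selected times: it is
tentatively picked and `A` satisfies the main budget constraint and the outer constraint. -/
def Accept {n ℓ : ℕ} {k Γ : ℝ} (a₄ : ℝ) (S : LPSolver n ℓ k Γ) (x : Fin n → Item)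
    (A : Finset (Fin n)) (t : Fin n) : Prop :=
  Tentative S x t ∧ ∑ s ∈ A, (x s).size ≤ k - 1 ∧
    ∑ s ∈ A with window ℓ s = window ℓ t, (x s).size ≤ a₄ * (ℓ / n) * k - 1

open Classical in
/-- The times selected by the primal algorithm among the first `i` time steps. -/
def primalSelect {n ℓ : ℕ} {k Γ : ℝ} (a₄ : ℝ) (S : LPSolver n ℓ k Γ) (x : Fin n → Item) :
    ℕ → Finset (Fin n)
  | 0 => ∅
  | i + 1 =>
    if h : i < n then
      if Accept a₄ S x (primalSelect a₄ S x i) ⟨i, h⟩ then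
        insert ⟨i, h⟩ (primalSelect a₄ S x i)
      else primalSelect a₄ S x i
    else primalSelect a₄ S x i

theorem lt_of_mem_primalSelect {n ℓ : ℕ} {k Γ : ℝ} (a₄ : ℝ) (S : LPSolver n ℓ k Γ)
    (x : Fin n → Item) (i : ℕ) (t : Fin n) (ht : t ∈ primalSelect a₄ S x i) : (t : ℕ) < i := by
  induction i with
  | zero => simp [primalSelect] at ht
  | succ i ih =>
    rw [primalSelect] at ht
    split_ifs at ht with h h'
    · rcases Finset.mem_insert.1 ht with rfl | ht
      · exact Nat.lt_succ_self i
      · exact (ih ht).trans (Nat.lt_succ_self i)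
    · exact (ih ht).trans (Nat.lt_succ_self i)
    · exact (ih ht).trans (Nat.lt_succ_self i)

theorem LPFeasible.congr {n ℓ : ℕ} {k Γ : ℝ} {x y : Fin n → Item} {t : Fin n}
    (h : ∀ s ≤ t, x s = y s) {X : Fin n → ℝ} (hX : LPFeasible ℓ k Γ x t X) :
    LPFeasible ℓ k Γ y t X where
  nonneg := hX.nonneg
  le_one := hX.le_one
  future := hX.future
  budget := by
    refine le_trans (le_of_eq (Finset.sum_congr rfl fun s hs => ?_)) hX.budget
    rw [h s (Finset.mem_Iic.1 hs)]
  inner j := by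
    refine le_trans (le_of_eq (Finset.sum_congr rfl fun s hs => ?_)) (hX.inner j)
    rw [h s (Finset.mem_Iic.1 (Finset.mem_filter.1 hs).1)]

theorem Accept.congr {n ℓ : ℕ} {k Γ : ℝ} {a₄ : ℝ} {S : LPSolver n ℓ k Γ} {x y : Fin n → Item}
    {t : Fin n} (h : ∀ s ≤ t, x s = y s) {A : Finset (Fin n)} (hA : ∀ s ∈ A, s ≤ t)
    (hx : Accept a₄ S x A t) : Accept a₄ S y A t := by
  obtain ⟨⟨⟨X, hX⟩, hpos⟩, h₁, h₂⟩ := hx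
  refine ⟨⟨⟨X, hX.congr h⟩, S.online x y t h ▸ hpos⟩, ?_, ?_⟩
  · refine le_trans (le_of_eq (Finset.sum_congr rfl fun s hs => ?_)) h₁
    rw [h s (hA s hs)]
  · refine le_trans (le_of_eq (Finset.sum_congr rfl fun s hs => ?_)) h₂
    rw [h s (hA s (Finset.mem_filter.1 hs).1)]

theorem primalSelect_congr {n ℓ : ℕ} {k Γ : ℝ} (a₄ : ℝ) (S : LPSolver n ℓ k Γ)
    {x y : Fin n → Item} (i : ℕ) (h : ∀ s : Fin n, (s : ℕ) < i → x s = y s) :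
    primalSelect a₄ S x i = primalSelect a₄ S y i := by
  induction i with
  | zero => rfl
  | succ i ih =>
    have ih' := ih fun s hs => h s (hs.trans (Nat.lt_succ_self i))
    rw [primalSelect, primalSelect, ih']
    by_cases hi : i < n
    · have hxy : ∀ s ≤ (⟨i, hi⟩ : Fin n), x s = y s := fun s hs =>
        h s (Nat.lt_succ_of_le (Fin.le_def.1 hs))
      have hA : ∀ s ∈ primalSelect a₄ S y i, s ≤ (⟨i, hi⟩ : Fin n) := fun s hs =>
        Fin.le_def.2 (lt_of_mem_primalSelect a₄ S y i s hs).le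
      have hiff : Accept a₄ S x (primalSelect a₄ S y i) ⟨i, hi⟩ ↔
          Accept a₄ S y (primalSelect a₄ S y i) ⟨i, hi⟩ :=
        ⟨fun H => H.congr hxy hA, fun H => H.congr (fun s hs => (hxy s hs).symm) hA⟩
      rw [dif_pos hi, dif_pos hi]
      by_cases hacc : Accept a₄ S y (primalSelect a₄ S y i) ⟨i, hi⟩
      · rw [if_pos hacc, if_pos (hiff.2 hacc)]
      · rw [if_neg hacc, if_neg fun H => hacc (hiff.1 H)]
    · simp only [hi, dif_neg, not_false_eq_true]

theorem mem_primalSelect_iff {n ℓ : ℕ} {k Γ : ℝ} (a₄ : ℝ) (S : LPSolver n ℓ k Γ)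
    (x : Fin n → Item) (t : Fin n) (i : ℕ) (hi : (t : ℕ) + 1 ≤ i) :
    t ∈ primalSelect a₄ S x i ↔ t ∈ primalSelect a₄ S x ((t : ℕ) + 1) := by
  induction i, hi using Nat.le_induction with
  | base => rfl
  | succ i hi ih =>
    rw [← ih, primalSelect]
    split_ifs with h h'
    · have hne : t ≠ ⟨i, h⟩ := fun H => by
        have := congrArg Fin.val H
        simp at this
        omega
      simp [Finset.mem_insert, hne]
    · rfl
    · rfl

/-- The primal algorithm with window-based inner and outer constraints. -/
def primalAlg {n ℓ : ℕ} {k Γ : ℝ} (a₄ : ℝ) (S : LPSolver n ℓ k Γ) : OnlineAlg n where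
  select x := primalSelect a₄ S x n
  online x y t h := by
    rw [mem_primalSelect_iff a₄ S x t n t.isLt, mem_primalSelect_iff a₄ S y t n t.isLt,
      primalSelect_congr a₄ S _ fun s hs => h s (Fin.le_def.2 (Nat.lt_succ_iff.1 hs))]

/-! ### The bursty adversary plus random order -/

/-- The choices of the adversary. `RO` is the set of random-order times; the other times are
adversarial and are covered by at most `Γ` windows. `item` lists the random-order items. An
assignment `I` of these items to the random-order times is drawn uniformly. The items at the
adversarial times are arbitrary functions of `I` and of the internal randomness `ω : Ω` of the
algorithm, hence in particular may react to the behaviour of the algorithm. -/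
structure Instance (n ℓ : ℕ) (Γ : ℝ) (Ω : Type) where
  RO : Finset (Fin n)
  cover : Finset ℕ
  card_cover : (cover.card : ℝ) ≤ Γ
  covers : ∀ t, t ∉ RO → window ℓ t ∈ cover
  item : Fin RO.card → Item
  item_valid : ∀ i, (item i).Valid
  adv : ({t // t ∈ RO} ≃ Fin RO.card) → Ω → Fin n → Item
  adv_valid : ∀ I ω t, (adv I ω t).Valid

namespace Instance

variable {n ℓ : ℕ} {Γ : ℝ} {Ω : Type}

/-- The sequence of items that is presented to the algorithm. -/
def arrival (B : Instance n ℓ Γ Ω) (I : {t // t ∈ B.RO} ≃ Fin B.RO.card) (ω : Ω) (t : Fin n) :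
    Item :=
  if h : t ∈ B.RO then B.item (I ⟨t, h⟩) else B.adv I ω t

/-- The fractional offline optimum of the random-order items. (The set is nonempty and bounded,
and the supremum is attained.) -/
def optRO (B : Instance n ℓ Γ Ω) (k : ℝ) : ℝ :=
  sSup {r | ∃ X : Fin B.RO.card → ℝ, (∀ i, 0 ≤ X i ∧ X i ≤ 1) ∧
    ∑ i, (B.item i).size * X i ≤ k ∧ r = ∑ i, (B.item i).value * X i}

/-- No two random-order items of positive size have the same value density. -/
def DistinctDensities (B : Instance n ℓ Γ Ω) : Prop :=
  ∀ i j, i ≠ j → 0 < (B.item i).size → 0 < (B.item j).size →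
    (B.item i).value / (B.item i).size ≠ (B.item j).value / (B.item j).size

/-- The expected value that the algorithm collects at the random-order times, where the internal
randomness `ω` of the algorithm is uniform on `Ω`, and the assignment `I` is uniform and
independent of `ω`. -/
def expectedValue [Fintype Ω] (B : Instance n ℓ Γ Ω) (A : Ω → OnlineAlg n) : ℝ :=
  𝔼 ω : Ω, 𝔼 I : {t // t ∈ B.RO} ≃ Fin B.RO.card,
    ∑ t ∈ B.RO with t ∈ (A ω).select (B.arrival I ω), (B.arrival I ω t).value

/-- The algorithm attains the competitive ratio on `B`, with constant `C` in the error terms. -/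
def Attains [Fintype Ω] (B : Instance n ℓ Γ Ω) (A : Ω → OnlineAlg n) (k C : ℝ) : Prop :=
  (1 - C * ((Γ * ℓ / n) * Real.log (n / (Γ * ℓ)))) * B.optRO k ≤ B.expectedValue A ∧
  (1 - C * ((Γ * Real.log k / k) * Real.log (k / (Γ * Real.log k)))) * B.optRO k
    ≤ B.expectedValue A

end Instance

end BARO

end

/-!
Call the densest random-order items of total size `k + 1` top items. By concentration for sampling
without replacement, with high probability every prefix of the stream contains its proportional
share of top items up to `O(Γ * ℓ / n * k)`, and no window outside the adversarial ones contains
more than `600 * ℓ / n * k` of them. On this event, whatever the at most `Γ` adversarial windows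
contain, the linear programs pick only top items outside these windows, so that the knapsack does
not fill up before the last `O(Γ * ℓ)` times; and an item that arrives outside these windows at
time `t` is picked as soon as it belongs to the densest items of total size
`(1 - O(Γ * ℓ / t)) * k`. Averaging this loss over `t` produces the logarithm.

Ties among densities are broken by multiplying the values by random factors close to `1`.
-/

noncomputable section

namespace BARO

open Finset

/-! ### Uniform probabilities -/

section Prob

variable {ι : Type*} [Fintype ι] {p q : ι → Prop}

open Classical in
/-- The probability of an event under the uniform distribution on a finite type (`0` on an empty
type). -/
def prob (p : ι → Prop) : ℝ := 𝔼 i, if p i then 1 else 0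

theorem prob_le_expect {F : ι → ℝ} (h0 : ∀ i, 0 ≤ F i) (h1 : ∀ i, p i → 1 ≤ F i) :
    prob p ≤ 𝔼 i, F i :=
  expect_le_expect fun i _ => by
    split_ifs with h
    exacts [h1 i h, h0 i]

theorem prob_mono (h : ∀ i, p i → q i) : prob p ≤ prob q :=
  prob_le_expect (fun i => by positivity) fun i hi => by rw [if_pos (h i hi)]

theorem prob_or_le (p q : ι → Prop) : prob (fun i => p i ∨ q i) ≤ prob p + prob q := by
  rw [prob, prob, prob, ← expect_add_distrib]
  refine expect_le_expect fun i _ => ?_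
  by_cases hp : p i <;> by_cases hq : q i <;> simp [hp, hq]

theorem one_sub_prob_not_le [Nonempty ι] (p : ι → Prop) : 1 - prob (fun i => ¬ p i) ≤ prob p := by
  rw [sub_le_iff_le_add, prob, prob, ← expect_add_distrib, ← Fintype.expect_const (ι := ι) (1 : ℝ)]
  refine expect_le_expect fun i _ => ?_
  by_cases hp : p i <;> simp [hp]

theorem prob_exists_le {κ : Type*} (s : Finset κ) (p : κ → ι → Prop) {c : ℝ}
    (h : ∀ j ∈ s, prob (p j) ≤ c) : prob (fun i => ∃ j ∈ s, p j i) ≤ #s * c := by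
  classical
  calc prob (fun i => ∃ j ∈ s, p j i)
      ≤ 𝔼 i, ∑ j ∈ s, (if p j i then (1 : ℝ) else 0) :=
        prob_le_expect (fun i => sum_nonneg fun j _ => by positivity) fun i ⟨j, hj, hji⟩ =>
          (if_pos hji).symm.trans_le <| single_le_sum
            (f := fun j => if p j i then (1 : ℝ) else 0) (fun j _ => by positivity) hj
    _ = ∑ j ∈ s, prob (p j) := by
        rw [expect_sum_comm]
        exact sum_congr rfl fun j _ => by unfold prob; congr!
    _ ≤ #s * c := by
        rw [← nsmul_eq_mul]
        exact sum_le_card_nsmul s _ c h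

end Prob

/-! ### Sampling without replacement -/

section RandomBijection

variable {α β : Type*} [Fintype α] [Fintype β] [DecidableEq α] [DecidableEq β]

theorem expect_perm_trans (σ : Equiv.Perm α) (F : (α ≃ β) → ℝ) :
    𝔼 I : α ≃ β, F (σ.trans I) = 𝔼 I : α ≃ β, F I :=
  Fintype.expect_equiv (σ.symm.equivCongr (Equiv.refl β)) _ _ fun _ => rfl

theorem prod_swap_trans_of_notMem {α β M : Type*} [DecidableEq α] [CommMonoid M] {a b : α}
    {A : Finset α} (ha : a ∉ A) (hb : b ∉ A) (f : β → M) (I : α ≃ β) :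
    ∏ s ∈ A, f ((Equiv.swap a b).trans I s) = ∏ s ∈ A, f (I s) :=
  prod_congr rfl fun s hs => by
    rw [Equiv.trans_apply, Equiv.swap_apply_of_ne_of_ne (ne_of_mem_of_not_mem hs ha)
      (ne_of_mem_of_not_mem hs hb)]

/-- A new sample is negatively correlated with the product over the earlier samples: if `b ∈ A`,
exchange `a` and `b` and use `f (I a) * f (I b) ≤ (f (I a) ^ 2 + f (I b) ^ 2) / 2`. -/
theorem expect_prod_mul_le {f : β → ℝ} (hf : ∀ i, 0 ≤ f i) {A : Finset α} {a : α} (ha : a ∉ A)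
    (b : α) :
    𝔼 I : α ≃ β, (∏ s ∈ A, f (I s)) * f (I a) ≤ 𝔼 I : α ≃ β, (∏ s ∈ A, f (I s)) * f (I b) := by
  by_cases hb : b ∈ A
  · set P : (α ≃ β) → ℝ := fun I => ∏ s ∈ A.erase b, f (I s)
    have hP : ∀ I : α ≃ β, ∏ s ∈ A, f (I s) = P I * f (I b) :=
      fun I => (prod_erase_mul A (fun s => f (I s)) hb).symm
    have hswap : 𝔼 I, P I * f (I a) ^ 2 = 𝔼 I, P I * f (I b) ^ 2 := by
      rw [← expect_perm_trans (Equiv.swap a b)]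
      refine expect_congr rfl fun I _ => ?_
      simp only [P]
      rw [prod_swap_trans_of_notMem (fun h => ha (mem_of_mem_erase h)) (notMem_erase b A)]
      simp
    calc 𝔼 I : α ≃ β, (∏ s ∈ A, f (I s)) * f (I a)
        ≤ 𝔼 I, (P I * f (I a) ^ 2 + P I * f (I b) ^ 2) / 2 := expect_le_expect fun I _ => by
          rw [hP]
          have hP0 : 0 ≤ P I := prod_nonneg fun s _ => hf _
          nlinarith [mul_nonneg hP0 (sq_nonneg (f (I a) - f (I b)))]
      _ = 𝔼 I, P I * f (I b) ^ 2 := by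
          rw [← expect_div, expect_add_distrib, hswap, add_self_div_two]
      _ = 𝔼 I : α ≃ β, (∏ s ∈ A, f (I s)) * f (I b) :=
          expect_congr rfl fun I _ => by rw [hP]; ring
  · refine le_of_eq ?_
    rw [← expect_perm_trans (Equiv.swap a b)]
    refine expect_congr rfl fun I _ => ?_
    rw [prod_swap_trans_of_notMem ha hb, Equiv.trans_apply, Equiv.swap_apply_left]

/-- Maclaurin's inequality, read as a comparison with sampling with replacement. -/
theorem expect_prod_le_expect_pow {f : β → ℝ} (hf : ∀ i, 0 ≤ f i) (A : Finset α) :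
    𝔼 I : α ≃ β, ∏ s ∈ A, f (I s) ≤ (𝔼 i, f i) ^ #A := by
  induction A using Finset.induction_on with
  | empty => rcases isEmpty_or_nonempty (α ≃ β) with h | h <;> simp
  | insert a A ha ih =>
    have : Nonempty α := ⟨a⟩
    calc 𝔼 I : α ≃ β, ∏ s ∈ insert a A, f (I s)
        = 𝔼 I : α ≃ β, (∏ s ∈ A, f (I s)) * f (I a) :=
          expect_congr rfl fun I _ => by rw [prod_insert ha, mul_comm]
      _ ≤ 𝔼 b : α, 𝔼 I : α ≃ β, (∏ s ∈ A, f (I s)) * f (I b) :=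
          le_expect univ_nonempty fun b _ => expect_prod_mul_le hf ha b
      _ = 𝔼 I : α ≃ β, (∏ s ∈ A, f (I s)) * 𝔼 i, f i := by
          rw [expect_comm]
          refine expect_congr rfl fun I _ => ?_
          rw [← mul_expect, Fintype.expect_equiv I _ f fun _ => rfl]
      _ = (𝔼 I : α ≃ β, ∏ s ∈ A, f (I s)) * 𝔼 i, f i := (expect_mul ..).symm
      _ ≤ (𝔼 i, f i) ^ #(insert a A) := by
          rw [card_insert_of_notMem ha, pow_succ]
          exact mul_le_mul_of_nonneg_right ih (expect_nonneg fun i _ => hf i)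

theorem exp_mul_le_one_add {c y : ℝ} (hc : |c| ≤ 1) (h0 : 0 ≤ y) (h1 : y ≤ 1) :
    Real.exp (c * y) ≤ 1 + (c + c ^ 2) * y := by
  have habs : |c * y| ≤ 1 := by
    rw [abs_mul, abs_of_nonneg h0]
    exact mul_le_one₀ hc h0 h1
  have hexp := (abs_le.1 (Real.abs_exp_sub_one_sub_id_le habs)).2
  nlinarith [mul_nonneg (sq_nonneg c) (mul_nonneg h0 (sub_nonneg.2 h1))]

theorem expect_exp_sum_le {g : β → ℝ} (h0 : ∀ i, 0 ≤ g i) (h1 : ∀ i, g i ≤ 1) (A : Finset α)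
    {c : ℝ} (hc : |c| ≤ 1) :
    𝔼 I : α ≃ β, Real.exp (c * ∑ s ∈ A, g (I s)) ≤
      Real.exp ((c + c ^ 2) * (#A * (𝔼 i, g i))) := by
  have hmean : 𝔼 i, Real.exp (c * g i) ≤ Real.exp ((c + c ^ 2) * 𝔼 i, g i) := by
    rcases isEmpty_or_nonempty β with hβ | hβ
    · simp
    · calc 𝔼 i, Real.exp (c * g i) ≤ 𝔼 i, (1 + (c + c ^ 2) * g i) :=
            expect_le_expect fun i _ => exp_mul_le_one_add hc (h0 i) (h1 i)
        _ = (c + c ^ 2) * 𝔼 i, g i + 1 := by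
            rw [expect_add_distrib, ← mul_expect, Fintype.expect_const, add_comm]
        _ ≤ _ := Real.add_one_le_exp _
  calc 𝔼 I : α ≃ β, Real.exp (c * ∑ s ∈ A, g (I s))
      = 𝔼 I : α ≃ β, ∏ s ∈ A, Real.exp (c * g (I s)) :=
        expect_congr rfl fun I _ => by rw [mul_sum, Real.exp_sum]
    _ ≤ (𝔼 i, Real.exp (c * g i)) ^ #A :=
        expect_prod_le_expect_pow (f := fun i => Real.exp (c * g i)) (fun i => Real.exp_nonneg _) A
    _ ≤ Real.exp ((c + c ^ 2) * 𝔼 i, g i) ^ #A :=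
        pow_le_pow_left₀ (expect_nonneg fun i _ => Real.exp_nonneg _) hmean _
    _ = Real.exp ((c + c ^ 2) * (#A * (𝔼 i, g i))) := by
        rw [← Real.exp_nat_mul, mul_left_comm]

/-- Chernoff's bound for sampling without replacement: the upper tail for `0 ≤ c` and the lower
tail for `c ≤ 0`. -/
theorem prob_le_mul_sum_sub_le {g : β → ℝ} (h0 : ∀ i, 0 ≤ g i) (h1 : ∀ i, g i ≤ 1) (A : Finset α)
    {c : ℝ} (hc : |c| ≤ 1) (r : ℝ) :
    prob (fun I : α ≃ β => r ≤ c * (∑ s ∈ A, g (I s) - #A * (𝔼 i, g i))) ≤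
      Real.exp (c ^ 2 * (#A * (𝔼 i, g i)) - r) := by
  set μ := #A * (𝔼 i, g i)
  calc prob (fun I : α ≃ β => r ≤ c * (∑ s ∈ A, g (I s) - μ))
      ≤ 𝔼 I : α ≃ β, Real.exp (c * ∑ s ∈ A, g (I s)) * Real.exp (-(c * μ + r)) :=
        prob_le_expect (fun I => by positivity) fun I hI => by
          rw [← Real.exp_add]
          exact Real.one_le_exp (by linarith)
    _ ≤ Real.exp ((c + c ^ 2) * μ) * Real.exp (-(c * μ + r)) := by
        rw [← expect_mul]
        exact mul_le_mul_of_nonneg_right (expect_exp_sum_le h0 h1 A hc) (Real.exp_nonneg _)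
    _ = Real.exp (c ^ 2 * μ - r) := by
        rw [← Real.exp_add]
        ring_nf

theorem abs_sum_swap_sub_le {α : Type*} [DecidableEq α] {h : α → ℝ} (h0 : ∀ s, 0 ≤ h s)
    (h1 : ∀ s, h s ≤ 1) (A : Finset α) (a b : α) :
    |∑ s ∈ A, h (Equiv.swap a b s) - ∑ s ∈ A, h s| ≤ 1 := by
  have hpt : ∀ s, h (Equiv.swap a b s) - h s =
      (if s = a then h b - h a else 0) + (if s = b then h a - h b else 0) := fun s => by
    rw [Equiv.swap_apply_def]
    split_ifs <;> simp_all
  rw [← sum_sub_distrib, sum_congr rfl fun s _ => hpt s, sum_add_distrib, sum_ite_eq', sum_ite_eq',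
    abs_le]
  have := h0 a; have := h0 b; have := h1 a; have := h1 b
  split_ifs <;> constructor <;> linarith

/-- A uniform bijection conditioned on `I a = i` becomes uniform again when the value at `a` is
exchanged with the value at a uniformly random point `b`. -/
theorem sum_expect_ite_swap_trans (a : α) (i : β) (F : (α ≃ β) → ℝ) :
    ∑ b : α, 𝔼 I : α ≃ β, (if I a = i then F ((Equiv.swap a b).trans I) else 0) =
      𝔼 I : α ≃ β, F I := by
  have hswap : ∀ b : α, 𝔼 I : α ≃ β, (if I a = i then F ((Equiv.swap a b).trans I) else 0) =
      𝔼 I : α ≃ β, (if I b = i then F I else 0) := fun b => by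
    rw [← expect_perm_trans (Equiv.swap a b)]
    refine expect_congr rfl fun I _ => ?_
    simp [← Equiv.trans_assoc]
  rw [sum_congr rfl fun b _ => hswap b, ← expect_sum_comm]
  refine expect_congr rfl fun I _ => ?_
  simp [← Equiv.eq_symm_apply]

theorem prob_le_card_mul_prob_apply_eq (a : α) (i : β) {p q : (α ≃ β) → Prop}
    (h : ∀ I b, q ((Equiv.swap a b).trans I) → p I) :
    prob q ≤ Fintype.card α * prob fun I : α ≃ β => I a = i ∧ p I := by
  classical
  rw [prob, ← sum_expect_ite_swap_trans a i, ← nsmul_eq_mul, ← card_univ, ← sum_const]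
  refine sum_le_sum fun b _ => expect_le_expect fun I _ => ?_
  by_cases hI : I a = i
  · by_cases hq : q ((Equiv.swap a b).trans I)
    · simp [hI, hq, h I b hq]
    · simp only [hI, hq, if_true, if_false]; positivity
  · simp [hI]

end RandomBijection

/-! ### The densest items -/

section Density

/-- The value density of an item. Division by zero makes it `0` for items of size zero, so it is
only compared between items of positive size. -/
def Item.density (y : Item) : ℝ := y.value / y.size

theorem Item.Valid.density_nonneg {y : Item} (hy : y.Valid) : 0 ≤ y.density :=
  div_nonneg hy.1 hy.2.1

theorem Item.density_mul_size {y : Item} (hy : 0 < y.size) : y.density * y.size = y.value :=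
  div_mul_cancel₀ _ hy.ne'

variable {ι : Type*} [Fintype ι] {it : ι → Item} {K : ℝ} {y z : Item}

open Classical in
/-- The total size of the items of the list `it` that are at least as dense as `y`. Items of size
zero are regarded as infinitely dense. -/
def load (it : ι → Item) (y : Item) : ℝ :=
  if 0 < y.size then ∑ i with y.density ≤ (it i).density, (it i).size else 0

open Classical in
/-- The size of `y` if `y` is a top item, that is, belongs to the densest items of total size `K`,
and `0` otherwise. -/
def topSize (it : ι → Item) (K : ℝ) (y : Item) : ℝ := if load it y ≤ K then y.size else 0

open Classical in
/-- The densest items of total size `K`. -/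
def topItems (it : ι → Item) (K : ℝ) : Finset ι := {i | load it (it i) ≤ K}

theorem mem_topItems {i : ι} : i ∈ topItems it K ↔ load it (it i) ≤ K := by simp [topItems]

theorem load_nonneg (hv : ∀ i, (it i).Valid) (y : Item) : 0 ≤ load it y := by
  unfold load
  split_ifs
  exacts [sum_nonneg fun i _ => (hv i).2.1, le_rfl]

theorem load_anti (hv : ∀ i, (it i).Valid) (hy : 0 < y.size) (h : y.density ≤ z.density) :
    load it z ≤ load it y := by
  by_cases hz : 0 < z.size
  · rw [load, load, if_pos hy, if_pos hz]
    exact sum_le_sum_of_subset_of_nonneg (monotone_filter_right _ fun i _ => h.trans)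
      fun i _ _ => (hv i).2.1
  · rw [load, if_neg hz]
    exact load_nonneg hv y

theorem size_pos_of_lt_load (hK : 0 ≤ K) (h : K < load it y) : 0 < y.size := by
  by_contra hy
  rw [load, if_neg hy] at h
  exact h.not_ge hK

theorem topSize_of_load_le (h : load it y ≤ K) : topSize it K y = y.size := if_pos h

theorem topSize_nonneg (hy : y.Valid) (K : ℝ) : 0 ≤ topSize it K y := by
  unfold topSize
  split_ifs
  exacts [hy.2.1, le_rfl]

theorem topSize_le_one (hy : y.Valid) (K : ℝ) : topSize it K y ≤ 1 := by
  unfold topSize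
  split_ifs
  exacts [hy.2.2, zero_le_one]

theorem size_mul_le_topSize (hy : y.Valid) {c : ℝ} (h0 : 0 ≤ c) (h1 : c ≤ 1)
    (h : 0 < y.size → 0 < c → load it y ≤ K) : y.size * c ≤ topSize it K y := by
  rcases hy.2.1.eq_or_lt with hs | hs
  · rw [← hs, zero_mul]; exact topSize_nonneg hy K
  rcases h0.eq_or_lt with hc | hc
  · rw [← hc, mul_zero]; exact topSize_nonneg hy K
  rw [topSize_of_load_le (h hs hc)]
  exact mul_le_of_le_one_right hs.le h1

theorem sum_topSize (it : ι → Item) (K : ℝ) :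
    ∑ i, topSize it K (it i) = ∑ i ∈ topItems it K, (it i).size := by
  simp only [topSize, topItems, sum_filter]

theorem sum_topSize_le (hv : ∀ i, (it i).Valid) (hK : 0 ≤ K) : ∑ i, topSize it K (it i) ≤ K := by
  classical
  rw [sum_topSize, ← sum_filter_of_ne (p := fun i => 0 < (it i).size)
    fun i _ hi => (hv i).2.1.lt_of_ne hi.symm]
  rcases (filter (fun i => 0 < (it i).size) (topItems it K)).eq_empty_or_nonempty with he | hne
  · simpa [he]
  · obtain ⟨i, hi, hmin⟩ := exists_min_image _ (fun i => (it i).density) hne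
    obtain ⟨hitop, hisize⟩ := mem_filter.1 hi
    rw [mem_topItems, load, if_pos hisize] at hitop
    refine (sum_le_sum_of_subset_of_nonneg (fun j hj => ?_) fun j _ _ => (hv j).2.1).trans hitop
    simpa using hmin j hj

/-- The density of the densest item outside the top is a threshold. Without ties, the top items and
this single item together overfill `K`. -/
theorem exists_density_threshold (hv : ∀ i, (it i).Valid)
    (hd : Set.InjOn (fun i => (it i).density) {i | 0 < (it i).size}) (hK : 0 ≤ K)
    (h : ∃ i, K < load it (it i)) :
    ∃ d : ℝ, 0 ≤ d ∧ (∀ i ∈ topItems it K, d * (it i).size ≤ (it i).value) ∧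
      (∀ i ∉ topItems it K, (it i).value ≤ d * (it i).size) ∧
      K - 1 < ∑ i ∈ topItems it K, (it i).size := by
  classical
  have hload : ∀ j ∉ topItems it K, K < load it (it j) := fun j hj => by
    simpa [mem_topItems] using hj
  have hpos : ∀ j ∉ topItems it K, 0 < (it j).size := fun j hj =>
    size_pos_of_lt_load hK (hload j hj)
  have hne : ({i | i ∉ topItems it K} : Finset ι).Nonempty := by
    obtain ⟨i, hi⟩ := h
    exact ⟨i, by simpa [mem_topItems] using hi⟩
  obtain ⟨i, hi, hmax⟩ := exists_max_image _ (fun i => (it i).density) hne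
  simp only [mem_filter, mem_univ, true_and] at hi hmax
  refine ⟨(it i).density, (hv i).density_nonneg, fun j hj => ?_, fun j hj => ?_, ?_⟩
  · rcases (hv j).2.1.eq_or_lt with h0 | h0
    · rw [← h0, mul_zero]; exact (hv j).1
    · rw [← Item.density_mul_size h0]
      refine mul_le_mul_of_nonneg_right ?_ h0.le
      by_contra! hlt
      exact hi (mem_topItems.2 ((load_anti hv h0 hlt.le).trans (mem_topItems.1 hj)))
  · rw [← Item.density_mul_size (hpos j hj)]
    exact mul_le_mul_of_nonneg_right (hmax j hj) (hpos j hj).le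
  · have hover : K < ∑ j ∈ insert i (topItems it K), (it j).size := by
      refine (hload i hi).trans_le ?_
      rw [load, if_pos (hpos i hi)]
      refine sum_le_sum_of_subset_of_nonneg (fun j hj => ?_) fun j _ _ => (hv j).2.1
      rw [mem_insert, or_iff_not_imp_right]
      exact fun hj' => hd (hpos j hj') (hpos i hi) ((hmax j hj').antisymm (mem_filter.1 hj).2)
    rw [sum_insert hi] at hover
    linarith [(hv i).2.2]

/-- Weak linear programming duality, with the dual solution that has price `d` per unit of size. -/
theorem sum_value_mul_le_of_threshold {T : Finset ι} {d k : ℝ} (hd : 0 ≤ d)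
    (htop : ∀ i ∈ T, d * (it i).size ≤ (it i).value)
    (hrest : ∀ i ∉ T, (it i).value ≤ d * (it i).size) {X : ι → ℝ}
    (hX : ∀ i, 0 ≤ X i ∧ X i ≤ 1) (hXk : ∑ i, (it i).size * X i ≤ k) :
    ∑ i, (it i).value * X i ≤ ∑ i ∈ T, (it i).value + d * (k - ∑ i ∈ T, (it i).size) := by
  classical
  have hreduced : ∑ i, ((it i).value - d * (it i).size) * X i ≤
      ∑ i ∈ T, ((it i).value - d * (it i).size) := by
    rw [← sum_add_sum_compl T, ← add_zero (∑ i ∈ T, ((it i).value - d * (it i).size))]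
    refine add_le_add (sum_le_sum fun i hi => ?_) (sum_nonpos fun i hi => ?_)
    · exact mul_le_of_le_one_right (sub_nonneg.2 (htop i hi)) (hX i).2
    · exact mul_nonpos_of_nonpos_of_nonneg (sub_nonpos.2 (hrest i (mem_compl.1 hi))) (hX i).1
  simp only [sub_mul, mul_assoc, sum_sub_distrib, ← mul_sum] at hreduced
  linarith [mul_le_mul_of_nonneg_left hXk hd]

theorem mul_sum_value_le (hv : ∀ i, (it i).Valid)
    (hd : Set.InjOn (fun i => (it i).density) {i | 0 < (it i).size}) {k : ℝ} (hK : 0 ≤ K)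
    (hKk : K ≤ k) {X : ι → ℝ} (hX : ∀ i, 0 ≤ X i ∧ X i ≤ 1) (hXk : ∑ i, (it i).size * X i ≤ k) :
    (K - 1) * ∑ i, (it i).value * X i ≤ k * ∑ i ∈ topItems it K, (it i).value := by
  have hVX : 0 ≤ ∑ i, (it i).value * X i := sum_nonneg fun i _ => mul_nonneg (hv i).1 (hX i).1
  have hV : 0 ≤ ∑ i ∈ topItems it K, (it i).value := sum_nonneg fun i _ => (hv i).1
  rcases le_or_gt K 1 with hK1 | hK1
  · exact (mul_nonpos_of_nonpos_of_nonneg (by linarith) hVX).trans (mul_nonneg (hK.trans hKk) hV)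
  by_cases hall : ∃ i, K < load it (it i)
  · obtain ⟨d, hd0, htop, hrest, hW⟩ := exists_density_threshold hv hd hK hall
    have hduality := sum_value_mul_le_of_threshold hd0 htop hrest hX hXk
    have hWK := sum_topSize_le hv hK
    have hVW := sum_le_sum htop
    rw [sum_topSize] at hWK
    rw [← mul_sum] at hVW
    set W := ∑ i ∈ topItems it K, (it i).size
    set V := ∑ i ∈ topItems it K, (it i).value
    calc (K - 1) * ∑ i, (it i).value * X i ≤ W * ∑ i, (it i).value * X i :=
          mul_le_mul_of_nonneg_right hW.le hVX
      _ ≤ W * (V + d * (k - W)) := mul_le_mul_of_nonneg_left hduality (by linarith)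
      _ = W * V + d * W * (k - W) := by ring
      _ ≤ W * V + V * (k - W) := by gcongr; linarith
      _ = k * V := by ring
  · push Not at hall
    have htop : topItems it K = univ := by ext i; simp [mem_topItems, hall i]
    rw [htop]
    calc (K - 1) * ∑ i, (it i).value * X i ≤ k * ∑ i, (it i).value * X i :=
          mul_le_mul_of_nonneg_right (by linarith) hVX
      _ ≤ k * ∑ i, (it i).value := mul_le_mul_of_nonneg_left
          (sum_le_sum fun i _ => mul_le_of_le_one_right (hv i).1 (hX i).2) (hK.trans hKk)

end Density

/-! ### Exchange arguments for the linear program -/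

section LinearProgram

/-- The amount `ℓ k / n` of knapsack that one window uses when the knapsack is filled at a constant
rate. It is of order `ln k`. -/
def share (n ℓ : ℕ) (k : ℝ) : ℝ := ℓ / n * k

/-- The right-hand side of the budget constraint of the linear program at time `t`, see
`lpBudget_eq`. -/
def lpBudget {n : ℕ} (ℓ : ℕ) (k Γ : ℝ) (t : Fin n) : ℝ :=
  ((t : ℝ) + 1) / n * k - 4 * (Γ * share n ℓ k)

/-- The size that a solution of the linear program at time `t` uses. -/
def usage {n : ℕ} (x : Fin n → Item) (X : Fin n → ℝ) (t : Fin n) : ℝ :=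
  ∑ q ∈ Iic t, (x q).size * X q

/-- The size that a solution of the linear program at time `t` uses in window `j`. -/
def windowUsage {n : ℕ} (ℓ : ℕ) (x : Fin n → Item) (X : Fin n → ℝ) (t : Fin n) (j : ℕ) : ℝ :=
  ∑ q ∈ Iic t with window ℓ q = j, (x q).size * X q

variable {n ℓ : ℕ} {k Γ : ℝ} {x : Fin n → Item} {s r t : Fin n} {X : Fin n → ℝ}

theorem lpBudget_eq (ℓ : ℕ) (k Γ : ℝ) (t : Fin n) :
    (1 - 4 * Γ * ℓ / ((t : ℝ) + 1)) * (((t : ℝ) + 1) / n) * k = lpBudget ℓ k Γ t := by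
  have ht : (t : ℝ) + 1 ≠ 0 := by positivity
  have hn : (n : ℝ) ≠ 0 := Nat.cast_ne_zero.2 t.pos.ne'
  rw [lpBudget, share]
  field_simp

theorem LPFeasible.usage_le (hX : LPFeasible ℓ k Γ x t X) : usage x X t ≤ lpBudget ℓ k Γ t :=
  hX.budget.trans_eq (lpBudget_eq ℓ k Γ t)

theorem LPFeasible.windowUsage_le (hX : LPFeasible ℓ k Γ x t X) (j : ℕ) :
    windowUsage ℓ x X t j ≤ 601 * share n ℓ k :=
  (hX.inner j).trans_eq (mul_assoc _ _ _)

theorem sum_mul_exchange {ι : Type*} [DecidableEq ι] (F : Finset ι) (u X : ι → ℝ) (s r : ι)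
    (a b : ℝ) :
    ∑ q ∈ F, u q * (X + Pi.single s a - Pi.single r b : ι → ℝ) q =
      ∑ q ∈ F, u q * X q + (if s ∈ F then u s * a else 0) - (if r ∈ F then u r * b else 0) := by
  simp [mul_sub, mul_add, sum_sub_distrib, sum_add_distrib, Pi.single_apply]

theorem LPFeasible.exchange (hX : LPFeasible ℓ k Γ x t X) (hx : ∀ s, (x s).Valid) (hs : s ≤ t)
    (hr : r ≤ t) {a b : ℝ} (ha : 0 ≤ a) (hb : 0 ≤ b) (hsa : X s + a ≤ 1) (hrb : b ≤ X r)
    (hbudget : usage x X t + (x s).size * a - (x r).size * b ≤ lpBudget ℓ k Γ t)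
    (hinner : windowUsage ℓ x X t (window ℓ s) + (x s).size * a -
      (if window ℓ r = window ℓ s then (x r).size * b else 0) ≤ 601 * share n ℓ k) :
    LPFeasible ℓ k Γ x t (X + Pi.single s a - Pi.single r b) where
  nonneg q := by
    have := hX.nonneg q
    simp only [Pi.sub_apply, Pi.add_apply, Pi.single_apply]
    split_ifs <;> subst_vars <;> linarith
  le_one q := by
    have := hX.le_one q
    simp only [Pi.sub_apply, Pi.add_apply, Pi.single_apply]
    split_ifs <;> subst_vars <;> linarith
  future q hq := by
    simp [hX.future q hq, (hs.trans_lt hq).ne', (hr.trans_lt hq).ne']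
  budget := by
    rw [lpBudget_eq, sum_mul_exchange, if_pos (mem_Iic.2 hs), if_pos (mem_Iic.2 hr)]
    exact hbudget
  inner j := by
    rw [sum_mul_exchange, mul_assoc]
    simp only [mem_filter, mem_Iic, hs, hr, true_and]
    rcases eq_or_ne (window ℓ s) j with rfl | hj
    · rw [if_pos rfl]
      exact hinner
    · have husage := hX.windowUsage_le j
      have hdrop := mul_nonneg (hx r).2.1 hb
      rw [windowUsage, share] at husage
      rw [if_neg hj]
      split_ifs <;> linarith

theorem LPOptimal.value_mul_le (hX : LPOptimal ℓ k Γ x t X) (hx : ∀ s, (x s).Valid) (hs : s ≤ t)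
    (hr : r ≤ t) {a b : ℝ} (ha : 0 ≤ a) (hb : 0 ≤ b) (hsa : X s + a ≤ 1) (hrb : b ≤ X r)
    (hbudget : usage x X t + (x s).size * a - (x r).size * b ≤ lpBudget ℓ k Γ t)
    (hinner : windowUsage ℓ x X t (window ℓ s) + (x s).size * a -
      (if window ℓ r = window ℓ s then (x r).size * b else 0) ≤ 601 * share n ℓ k) :
    (x s).value * a ≤ (x r).value * b := by
  have hopt := hX.2 _ (hX.1.exchange hx hs hr ha hb hsa hrb hbudget hinner)
  rw [sum_mul_exchange, if_pos (mem_Iic.2 hs), if_pos (mem_Iic.2 hr)] at hopt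
  linarith

theorem exists_pos_le_le_le {R : Type*} [LinearOrder R] [Zero R] {a b c : R} (ha : 0 < a)
    (hb : 0 < b) (hc : 0 < c) : ∃ δ > 0, δ ≤ a ∧ δ ≤ b ∧ δ ≤ c :=
  ⟨min a (min b c), lt_min ha (lt_min hb hc), min_le_left _ _,
    (min_le_right _ _).trans (min_le_left _ _), (min_le_right _ _).trans (min_le_right _ _)⟩

theorem LPOptimal.density_le (hX : LPOptimal ℓ k Γ x t X) (hx : ∀ s, (x s).Valid) (hs : s ≤ t)
    (hr : r ≤ t) (hws : 0 < (x s).size) (hwr : 0 < (x r).size) (hXs : X s < 1) (hXr : 0 < X r)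
    (h : window ℓ r = window ℓ s ∨ windowUsage ℓ x X t (window ℓ s) < 601 * share n ℓ k) :
    (x s).density ≤ (x r).density := by
  obtain ⟨c, hc, hroom⟩ : ∃ c > 0, ∀ δ ≤ c, 0 ≤ δ → windowUsage ℓ x X t (window ℓ s) + δ -
      (if window ℓ r = window ℓ s then δ else 0) ≤ 601 * share n ℓ k := by
    rcases h with h | h
    · refine ⟨1, one_pos, fun δ _ _ => ?_⟩
      rw [if_pos h, add_sub_cancel_right]
      exact hX.1.windowUsage_le _
    · refine ⟨_, sub_pos.2 h, fun δ hδ _ => ?_⟩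
      split_ifs <;> linarith
  obtain ⟨δ, hδ, hδs, hδr, hδc⟩ :=
    exists_pos_le_le_le (mul_pos (sub_pos.2 hXs) hws) (mul_pos hXr hwr) hc
  have es : (x s).size * (δ / (x s).size) = δ := mul_div_cancel₀ _ hws.ne'
  have er : (x r).size * (δ / (x r).size) = δ := mul_div_cancel₀ _ hwr.ne'
  have hexchange := hX.value_mul_le hx hs hr (a := δ / (x s).size) (b := δ / (x r).size)
    (by positivity) (by positivity) (by linarith [(div_le_iff₀ hws).2 hδs])
    ((div_le_iff₀ hwr).2 hδr)
    (by rw [es, er, add_sub_cancel_right]; exact hX.1.usage_le)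
    (by rw [es, er]; exact hroom δ hδc hδ.le)
  rw [mul_div_left_comm, mul_div_left_comm (x r).value] at hexchange
  exact le_of_mul_le_mul_left hexchange hδ

theorem LPOptimal.value_nonpos_of_room (hX : LPOptimal ℓ k Γ x t X) (hx : ∀ s, (x s).Valid)
    (hs : s ≤ t) {a : ℝ} (ha : 0 < a) (hsa : X s + a ≤ 1)
    (hbudget : usage x X t + (x s).size * a ≤ lpBudget ℓ k Γ t)
    (hinner : windowUsage ℓ x X t (window ℓ s) + (x s).size * a ≤ 601 * share n ℓ k) :
    (x s).value ≤ 0 := by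
  have hvalue := hX.value_mul_le hx hs hs ha.le le_rfl hsa (hX.1.nonneg s) (by simpa using hbudget)
    (by simpa using hinner)
  rw [mul_zero] at hvalue
  exact nonpos_of_mul_nonpos_left hvalue ha

theorem LPOptimal.size_pos (hX : LPOptimal ℓ k Γ x t X) (hx : ∀ s, (x s).Valid) (hs : s ≤ t)
    (hv : 0 < (x s).value) (hXs : X s < 1) : 0 < (x s).size := by
  refine (hx s).2.1.lt_of_ne fun h0 => hv.not_ge ?_
  refine hX.value_nonpos_of_room hx hs (sub_pos.2 hXs) (by linarith) ?_ ?_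
  · rw [← h0, zero_mul, add_zero]; exact hX.1.usage_le
  · rw [← h0, zero_mul, add_zero]; exact hX.1.windowUsage_le _

theorem LPOptimal.budget_tight (hX : LPOptimal ℓ k Γ x t X) (hx : ∀ s, (x s).Valid) (hs : s ≤ t)
    (hv : 0 < (x s).value) (hXs : X s < 1)
    (hinner : windowUsage ℓ x X t (window ℓ s) < 601 * share n ℓ k) :
    lpBudget ℓ k Γ t ≤ usage x X t := by
  by_contra! hbudget
  obtain ⟨a, ha, haX, hab, hai⟩ :=
    exists_pos_le_le_le (sub_pos.2 hXs) (sub_pos.2 hbudget) (sub_pos.2 hinner)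
  have hsize : (x s).size * a ≤ a := mul_le_of_le_one_left ha.le (hx s).2.2
  exact hv.not_ge (hX.value_nonpos_of_room hx hs ha (by linarith) (by linarith) (by linarith))

/-- Within the window of `s` exchanges are always possible, so only items at least as dense as `s`
are used there. -/
theorem LPOptimal.windowUsage_lt {ι : Type*} [Fintype ι] {it : ι → Item} {K : ℝ}
    (hX : LPOptimal ℓ k Γ x t X) (hx : ∀ s, (x s).Valid) (hv : ∀ i, (it i).Valid) (hs : s ≤ t)
    (hws : 0 < (x s).size) (hXs : X s < 1) (hload : load it (x s) ≤ K)
    (hsum : ∑ q with window ℓ q = window ℓ s, topSize it K (x q) < 601 * share n ℓ k) :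
    windowUsage ℓ x X t (window ℓ s) < 601 * share n ℓ k := by
  refine lt_of_le_of_lt ((sum_le_sum fun q hq => ?_).trans (sum_le_sum_of_subset_of_nonneg
    (filter_subset_filter _ (subset_univ _)) fun q _ _ => topSize_nonneg (hx q) K)) hsum
  obtain ⟨hqt, hqw⟩ := mem_filter.1 hq
  exact size_mul_le_topSize (hx q) (hX.1.nonneg q) (hX.1.le_one q) fun hwq hXq =>
    (load_anti hv hws
      (hX.density_le hx hs (mem_Iic.1 hqt) hws hwq hXs hXq (Or.inl hqw))).trans hload

end LinearProgram

/-! ### Windows and prefixes -/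

section Counting

variable {n ℓ i : ℕ} {cover : Finset ℕ}

theorem window_mem_range (t : Fin n) : window ℓ t ∈ range (n / ℓ + 1) :=
  mem_range.2 (Nat.lt_succ_of_le (Nat.div_le_div_right t.isLt.le))

theorem window_mul_le (ℓ : ℕ) (t : Fin n) : window ℓ t * ℓ ≤ t := Nat.div_mul_le_self _ _

theorem lt_window_mul_add (hℓ : 0 < ℓ) (t : Fin n) : (t : ℕ) < window ℓ t * ℓ + ℓ :=
  Nat.lt_div_mul_add hℓ

theorem card_window_le (hℓ : 0 < ℓ) (j : ℕ) : #{s : Fin n | window ℓ s = j} ≤ ℓ := by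
  have hinj : #{s : Fin n | window ℓ s = j} ≤ #(Finset.Ico (j * ℓ) (j * ℓ + ℓ)) := by
    refine card_le_card_of_injOn (fun s => (s : ℕ)) (fun s hs => ?_) fun s _ r _ h => Fin.ext h
    obtain rfl := (mem_filter.1 (mem_coe.1 hs)).2
    exact mem_coe.2 (mem_Ico.2 ⟨window_mul_le ℓ s, lt_window_mul_add hℓ s⟩)
  simpa using hinj

theorem card_covered_le (hℓ : 0 < ℓ) (cover : Finset ℕ) :
    #{s : Fin n | window ℓ s ∈ cover} ≤ #cover * ℓ := by
  rw [mul_comm]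
  refine card_le_mul_card_image_of_maps_to (f := fun s : Fin n => window ℓ s)
    (fun s hs => (mem_filter.1 hs).2) ℓ fun j _ => ?_
  exact (card_le_card (filter_subset_filter _ (subset_univ _))).trans (card_window_le hℓ j)

/-- The times before step `i` outside the covered windows. -/
def freePrefix (n ℓ : ℕ) (cover : Finset ℕ) (i : ℕ) : Finset (Fin n) :=
  {s | window ℓ s ∉ cover ∧ (s : ℕ) < i}

theorem mem_freePrefix {s : Fin n} :
    s ∈ freePrefix n ℓ cover i ↔ window ℓ s ∉ cover ∧ (s : ℕ) < i := by
  simp [freePrefix]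

theorem card_freePrefix_le (n ℓ : ℕ) (cover : Finset ℕ) (i : ℕ) :
    #(freePrefix n ℓ cover i) ≤ i := by
  refine (card_le_card (t := {s : Fin n | (s : ℕ) < i}) fun s hs => ?_).trans ?_
  · simpa using (mem_freePrefix.1 hs).2
  · rw [Fin.card_filter_val_lt]
    exact min_le_right _ _

theorem sub_le_card_freePrefix (hℓ : 0 < ℓ) (cover : Finset ℕ) (hi : i ≤ n) :
    (i : ℝ) - #cover * ℓ ≤ #(freePrefix n ℓ cover i) := by
  have hunion : #{s : Fin n | (s : ℕ) < i} ≤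
      #{s : Fin n | window ℓ s ∈ cover} + #(freePrefix n ℓ cover i) := by
    refine (card_le_card fun s hs => ?_).trans (card_union_le _ _)
    simp only [mem_filter, mem_univ, true_and, mem_union, mem_freePrefix] at hs ⊢
    tauto
  rw [Fin.card_filter_val_lt, min_eq_right hi] at hunion
  rw [sub_le_iff_le_add']
  exact_mod_cast hunion.trans (Nat.add_le_add_right (card_covered_le hℓ cover) _)

theorem sum_filter_mem_le_card_mul {α κ : Type*} [DecidableEq κ] (A : Finset α) (g : α → κ)
    (C : Finset κ) {f : α → ℝ} {c : ℝ} (h : ∀ j ∈ C, ∑ s ∈ A with g s = j, f s ≤ c) :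
    ∑ s ∈ A with g s ∈ C, f s ≤ #C * c := by
  rw [← sum_fiberwise_of_maps_to (t := C) (g := g) fun s hs => (mem_filter.1 hs).2,
    ← nsmul_eq_mul]
  refine sum_le_card_nsmul C _ c fun j hj => ?_
  rw [filter_filter, filter_congr fun s _ => and_iff_right_of_imp fun hs : g s = j => hs ▸ hj]
  exact h j hj

end Counting

/-! ### The behaviour of the algorithm on typical arrival orders -/

/-- The size of the densest items of total size `K` that arrive before step `i` and outside the
covered windows. -/
def prefixSize {n m : ℕ} (ℓ : ℕ) (it : Fin m → Item) (cover : Finset ℕ) (K : ℝ)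
    (x : Fin n → Item) (i : ℕ) : ℝ :=
  ∑ s ∈ freePrefix n ℓ cover i, topSize it K (x s)

/-- The expectation of `prefixSize` over the uniformly random arrival order. -/
def prefixMean {m : ℕ} (n ℓ : ℕ) (it : Fin m → Item) (cover : Finset ℕ) (K : ℝ) (i : ℕ) : ℝ :=
  #(freePrefix n ℓ cover i) * (𝔼 j, topSize it K (it j))

/-- The ranges of the parameters, with `m` random-order items. -/
structure Regime (n ℓ m : ℕ) (k Γ : ℝ) : Prop where
  k_ge : 80 ≤ k
  k_le : k ≤ (n : ℝ) / 2
  ell_pos : 0 < ℓ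
  one_le_share : 1 ≤ share n ℓ k
  Γ_ge : 1 ≤ Γ
  burst_le : Γ * ℓ / n ≤ 1 / 2
  m_le : m ≤ n
  le_m : (n : ℝ) ≤ m + Γ * ℓ
  le_sq : k ≤ Γ ^ 2
  log_le : Real.log k ≤ share n ℓ k + 1 / 2

namespace Regime

variable {n ℓ m : ℕ} {k Γ : ℝ} (R : Regime n ℓ m k Γ)
include R

theorem k_pos : 0 < k := by linarith [R.k_ge]

theorem n_pos : (0 : ℝ) < n := by linarith [R.k_ge, R.k_le]

theorem n_le_two_mul : (n : ℝ) ≤ 2 * m := by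
  have hburst := R.burst_le
  rw [div_le_iff₀ R.n_pos] at hburst
  linarith [R.le_m]

theorem m_pos : (0 : ℝ) < m := by linarith [R.n_le_two_mul, R.n_pos]

theorem burst_pos : 0 < Γ * ℓ :=
  mul_pos (by linarith [R.Γ_ge]) (Nat.cast_pos.2 R.ell_pos)

theorem share_le : share n ℓ k ≤ Γ * share n ℓ k :=
  le_mul_of_one_le_left (zero_le_one.trans R.one_le_share) R.Γ_ge

theorem log_ge : 1 / 2 ≤ Real.log (n / (Γ * ℓ)) := by
  have hburst := R.burst_le
  rw [div_le_iff₀ R.n_pos] at hburst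
  have htwo : (2 : ℝ) ≤ n / (Γ * ℓ) := by
    rw [le_div_iff₀ R.burst_pos]; linarith
  linarith [Real.log_le_log two_pos htwo, Real.log_two_gt_d9]

theorem inv_le : 1 / k ≤ Γ * ℓ / n := by
  have hshare := R.one_le_share.trans R.share_le
  rw [share, show Γ * ((ℓ : ℝ) / n * k) = Γ * ℓ * k / n by ring, le_div_iff₀ R.n_pos] at hshare
  rwa [div_le_div_iff₀ R.k_pos R.n_pos]

theorem div_card_le {i : ℝ} (hi : i ≤ n) : i / m ≤ i / n + 2 * (Γ * ℓ / n) := by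
  rw [← mul_div_assoc, ← add_div, div_le_div_iff₀ R.m_pos R.n_pos]
  have hm : (m : ℝ) ≤ n := Nat.cast_le.2 R.m_le
  calc i * n = i * m + i * (n - m) := by ring
    _ ≤ i * m + n * (Γ * ℓ) := by
        have := mul_le_mul hi (by linarith [R.le_m] : (n : ℝ) - m ≤ Γ * ℓ) (sub_nonneg.2 hm)
          (Nat.cast_nonneg n)
        gcongr
    _ ≤ i * m + 2 * m * (Γ * ℓ) := by
        gcongr
        exacts [R.burst_pos.le, R.n_le_two_mul]
    _ = (i + 2 * (Γ * ℓ)) * m := by ring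

theorem prefixMean_le {it : Fin m → Item} (hv : ∀ i, (it i).Valid) (cover : Finset ℕ) {K : ℝ}
    (hK : 0 ≤ K) {i : ℕ} (hi : i ≤ n) :
    prefixMean n ℓ it cover K i ≤ (i / n + 2 * (Γ * ℓ / n)) * K := by
  rw [prefixMean, Fintype.expect_eq_sum_div_card, Fintype.card_fin]
  calc #(freePrefix n ℓ cover i) * ((∑ j, topSize it K (it j)) / m) ≤ (i : ℝ) * (K / m) := by
        refine mul_le_mul (Nat.cast_le.2 (card_freePrefix_le n ℓ cover i)) ?_ ?_ (Nat.cast_nonneg _)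
        · exact div_le_div_of_nonneg_right (sum_topSize_le hv hK) R.m_pos.le
        · exact div_nonneg (sum_nonneg fun j _ => topSize_nonneg (hv j) K) R.m_pos.le
    _ = i / m * K := by ring
    _ ≤ _ := mul_le_mul_of_nonneg_right (R.div_card_le (Nat.cast_le.2 hi)) hK

theorem le_prefixMean {it : Fin m → Item} {cover : Finset ℕ} (hc : #cover ≤ Γ) {K : ℝ}
    (hW : k ≤ ∑ i, topSize it K (it i)) (t : Fin n) :
    ((t : ℝ) + 1) / n * k - share n ℓ k - Γ * share n ℓ k ≤
      prefixMean n ℓ it cover K (window ℓ t * ℓ) := by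
  rw [prefixMean, Fintype.expect_eq_sum_div_card, Fintype.card_fin]
  have hcard : (t : ℝ) + 1 - ℓ - Γ * ℓ ≤ #(freePrefix n ℓ cover (window ℓ t * ℓ)) := by
    have hprefix := sub_le_card_freePrefix R.ell_pos cover ((window_mul_le ℓ t).trans t.isLt.le)
    have ht : (t : ℝ) + 1 ≤ ((window ℓ t * ℓ : ℕ) : ℝ) + ℓ := by
      exact_mod_cast lt_window_mul_add R.ell_pos t
    linarith [mul_le_mul_of_nonneg_right hc (Nat.cast_nonneg (α := ℝ) ℓ)]
  have hk := R.k_pos.le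
  calc ((t : ℝ) + 1) / n * k - share n ℓ k - Γ * share n ℓ k
      = ((t : ℝ) + 1 - ℓ - Γ * ℓ) * (k / n) := by rw [share]; ring
    _ ≤ #(freePrefix n ℓ cover (window ℓ t * ℓ)) * (k / n) := by gcongr
    _ ≤ #(freePrefix n ℓ cover (window ℓ t * ℓ)) * ((∑ j, topSize it K (it j)) / m) := by
        have hm := R.m_pos
        gcongr
        exacts [hk.trans hW, R.m_le]

theorem zero_lpFeasible (x : Fin n → Item) {t : Fin n} (ht : 4 * (Γ * ℓ) ≤ (t : ℝ) + 1) :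
    LPFeasible ℓ k Γ x t 0 where
  nonneg _ := le_rfl
  le_one _ := zero_le_one
  future _ _ := rfl
  budget := by
    rw [lpBudget_eq, lpBudget, share, show ((t : ℝ) + 1) / n * k - 4 * (Γ * (ℓ / n * k)) =
      ((t : ℝ) + 1 - 4 * (Γ * ℓ)) * (k / n) by ring]
    simpa using mul_nonneg (sub_nonneg.2 ht) (div_nonneg R.k_pos.le R.n_pos.le)
  inner _ := by
    have hshare := R.one_le_share
    rw [share] at hshare
    simp only [Pi.zero_apply, mul_zero, sum_const_zero]
    linarith

end Regime

/-- The typical behaviour of an arrival order: no window outside the cover is overfull with top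
items, and every prefix of complete windows holds almost its share of them. The bounds hold with a
margin of `δ`; exchanging two items costs a margin of `1`. -/
structure Typical {n m : ℕ} (δ : ℝ) (ℓ : ℕ) (k Γ : ℝ) (it : Fin m → Item) (cover : Finset ℕ)
    (x : Fin n → Item) : Prop where
  inner : ∀ j ∈ range (n / ℓ + 1), j ∉ cover →
    ∑ q with window ℓ q = j, topSize it (k + 1) (x q) ≤ 600 * share n ℓ k - δ
  lower : ∀ j ∈ range (n / ℓ + 1),
    prefixMean n ℓ it cover (k + 1) (j * ℓ) - (Γ * share n ℓ k - δ) ≤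
      prefixSize ℓ it cover (k + 1) x (j * ℓ)

/-- Typical arrival orders for which, moreover, the prefixes at time `t` are not overfull: neither
with top items nor with the densest items of total size `K`. -/
structure TypicalAt {n m : ℕ} (δ : ℝ) (ℓ : ℕ) (k Γ : ℝ) (it : Fin m → Item) (cover : Finset ℕ)
    (K : ℝ) (t : Fin n) (x : Fin n → Item) : Prop extends Typical δ ℓ k Γ it cover x where
  upper : prefixSize ℓ it cover K x (t + 1) ≤
    prefixMean n ℓ it cover K (t + 1) + (Γ * share n ℓ k - δ)
  upper_top : prefixSize ℓ it cover (k + 1) x t ≤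
    prefixMean n ℓ it cover (k + 1) t + (Γ * share n ℓ k - δ)

section Tentative

variable {n ℓ m : ℕ} {k K Γ : ℝ} {it : Fin m → Item} {cover : Finset ℕ} {x : Fin n → Item}
  {s t : Fin n} {X : Fin n → ℝ}

theorem prefixSize_le_usage (hx : ∀ s, (x s).Valid) (hX : LPFeasible ℓ k Γ x t X)
    (hone : ∀ s ≤ t, window ℓ s ∉ cover → load it (x s) ≤ K → 0 < (x s).size → X s = 1) {i : ℕ}
    (hi : i ≤ t) : prefixSize ℓ it cover K x i ≤ usage x X t := by
  have hle : ∀ s ∈ freePrefix n ℓ cover i, s ≤ t := fun s hs =>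
    Fin.le_def.2 ((mem_freePrefix.1 hs).2.le.trans hi)
  refine (sum_le_sum (g := fun s => (x s).size * X s) fun s hs => ?_).trans
    (sum_le_sum_of_subset_of_nonneg (fun s hs => mem_Iic.2 (hle s hs)) fun s _ _ =>
      mul_nonneg (hx s).2.1 (hX.nonneg s))
  unfold topSize
  split_ifs with hload
  · rcases (hx s).2.1.eq_or_lt with h0 | hpos
    · rw [← h0, zero_mul]
    · rw [hone s (hle s hs) (mem_freePrefix.1 hs).1 hload hpos, mul_one]
  · exact mul_nonneg (hx s).2.1 (hX.nonneg s)

theorem sum_le_mul_add_prefixSize (hx : ∀ s, (x s).Valid) (hc : #cover ≤ Γ) {A : Finset (Fin n)}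
    {f : Fin n → ℝ} {c : ℝ} (hc0 : 0 ≤ c)
    (hwindow : ∀ j ∈ cover, ∑ s ∈ A with window ℓ s = j, f s ≤ c)
    (hfree : ∀ s ∈ A, window ℓ s ∉ cover → f s ≤ topSize it K (x s)) {i : ℕ}
    (hA : ∀ s ∈ A, (s : ℕ) < i) : ∑ s ∈ A, f s ≤ Γ * c + prefixSize ℓ it cover K x i := by
  rw [← sum_filter_add_sum_filter_not A fun s => window ℓ s ∈ cover]
  refine add_le_add ((sum_filter_mem_le_card_mul A _ cover hwindow).trans
    (mul_le_mul_of_nonneg_right hc hc0)) ?_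
  refine (sum_le_sum fun s hs => hfree s (mem_filter.1 hs).1 (mem_filter.1 hs).2).trans ?_
  refine sum_le_sum_of_subset_of_nonneg (fun s hs => ?_) fun s _ _ => topSize_nonneg (hx s) K
  exact mem_freePrefix.2 ⟨(mem_filter.1 hs).2, hA s (mem_filter.1 hs).1⟩

theorem Typical.windowUsage_lt (R : Regime n ℓ m k Γ) (hT : Typical 0 ℓ k Γ it cover x)
    (hv : ∀ i, (it i).Valid) (hx : ∀ s, (x s).Valid) (hX : LPOptimal ℓ k Γ x t X) (hs : s ≤ t)
    (hsc : window ℓ s ∉ cover) (hload : load it (x s) ≤ k + 1) (hws : 0 < (x s).size)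
    (hXs : X s < 1) : windowUsage ℓ x X t (window ℓ s) < 601 * share n ℓ k :=
  hX.windowUsage_lt hx hv hs hws hXs hload <|
    (hT.inner _ (window_mem_range s) hsc).trans_lt (by linarith [R.one_le_share])

theorem Typical.eq_one_of_load_le (R : Regime n ℓ m k Γ) (hT : Typical 0 ℓ k Γ it cover x)
    (hv : ∀ i, (it i).Valid) (hx : ∀ s, (x s).Valid) (hX : LPOptimal ℓ k Γ x t X)
    (hXt : 0 < X t) (ht : k + 1 < load it (x t)) (hs : s ≤ t) (hsc : window ℓ s ∉ cover)
    (hload : load it (x s) ≤ k + 1) (hws : 0 < (x s).size) : X s = 1 := by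
  by_contra hne
  have hXs : X s < 1 := (hX.1.le_one s).lt_of_ne hne
  have hwt := size_pos_of_lt_load (by linarith [R.k_ge]) ht
  have hdensity := hX.density_le hx hs le_rfl hws hwt hXs hXt
    (Or.inr (hT.windowUsage_lt R hv hx hX hs hsc hload hws hXs))
  exact ((load_anti hv hws hdensity).trans hload).not_gt ht

/-- If a sparse item were used at time `t`, then all earlier top items would be used completely,
and on a typical order these already exceed the budget. -/
theorem Typical.load_le (R : Regime n ℓ m k Γ) (hT : Typical 0 ℓ k Γ it cover x)
    (hv : ∀ i, (it i).Valid) (hx : ∀ s, (x s).Valid) (hc : #cover ≤ Γ)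
    (hW : k + 1 < load it (x t) → k < ∑ i, topSize it (k + 1) (it i))
    (hX : LPOptimal ℓ k Γ x t X) (hXt : 0 < X t) : load it (x t) ≤ k + 1 := by
  by_contra! hload
  have hused := prefixSize_le_usage hx hX.1
    (fun s hs hsc hls hws => hT.eq_one_of_load_le R hv hx hX hXt hload hs hsc hls hws)
    (window_mul_le ℓ t)
  have hbudget := hX.1.usage_le
  rw [lpBudget] at hbudget
  linarith [R.le_prefixMean hc (hW hload).le t, hT.lower _ (window_mem_range t), R.share_le,
    R.one_le_share]

/-- If a dense item were not used at time `t`, then the budget would be exhausted by items that are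
at least as dense; on a typical order there are too few of them. -/
theorem TypicalAt.pos_of_load_le (R : Regime n ℓ m k Γ)
    (hT : TypicalAt 0 ℓ k Γ it cover K t x)
    (hv : ∀ i, (it i).Valid) (hx : ∀ s, (x s).Valid) (hc : #cover ≤ Γ)
    (ht : window ℓ t ∉ cover) (hK : 0 ≤ K)
    (hKt : K * ((t : ℝ) + 1) ≤ k * ((t : ℝ) + 1 - 609 * (Γ * ℓ)))
    (hload : load it (x t) ≤ K) (hval : 0 < (x t).value)
    (hX : LPOptimal ℓ k Γ x t X) : 0 < X t := by
  by_contra hneg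
  have hXt : X t < 1 := by linarith
  have hb := R.burst_pos
  have hKk : K ≤ k := by
    refine le_of_mul_le_mul_right (hKt.trans ?_) (by positivity : (0 : ℝ) < (t : ℝ) + 1)
    exact mul_le_mul_of_nonneg_left (by linarith) R.k_pos.le
  have hwt := hX.size_pos hx le_rfl hval hXt
  have hwindow := hT.windowUsage_lt R hv hx hX le_rfl ht (by linarith) hwt hXt
  have htight := hX.budget_tight hx le_rfl hval hXt hwindow
  have hused : usage x X t ≤ Γ * (601 * share n ℓ k) + prefixSize ℓ it cover K x (t + 1) := by
    refine sum_le_mul_add_prefixSize hx hc (by linarith [R.one_le_share])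
      (fun j _ => hX.1.windowUsage_le j) (fun s hs _ => ?_)
      fun s hs => Nat.lt_succ_of_le (Fin.le_def.1 (mem_Iic.1 hs))
    exact size_mul_le_topSize (hx s) (hX.1.nonneg s) (hX.1.le_one s) fun hws hXs =>
      (load_anti hv hwt (hX.density_le hx le_rfl (mem_Iic.1 hs) hwt hws hXt hXs
        (Or.inr hwindow))).trans hload
  have hmean : prefixMean n ℓ it cover K (t + 1) ≤
      ((t : ℝ) + 1) / n * k - 607 * (Γ * share n ℓ k) := by
    refine (R.prefixMean_le hv cover hK t.isLt).trans ?_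
    calc ((↑(t + 1 : ℕ) : ℝ) / n + 2 * (Γ * ℓ / n)) * K
        = (K * ((t : ℝ) + 1) + 2 * (Γ * ℓ) * K) / n := by push_cast; ring
      _ ≤ (k * ((t : ℝ) + 1 - 609 * (Γ * ℓ)) + 2 * (Γ * ℓ) * k) / n := by gcongr
      _ = ((t : ℝ) + 1) / n * k - 607 * (Γ * share n ℓ k) := by rw [share]; ring
  rw [lpBudget] at htight
  linarith [hT.upper, R.share_le, R.one_le_share]

end Tentative

section Acceptance

variable {n ℓ : ℕ} {k Γ a₄ : ℝ} {S : LPSolver n ℓ k Γ} {x : Fin n → Item}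

theorem tentative_of_mem_primalSelect {i : ℕ} {s : Fin n} (hs : s ∈ primalSelect a₄ S x i) :
    Tentative S x s := by
  induction i with
  | zero => simp [primalSelect] at hs
  | succ i ih =>
    rw [primalSelect] at hs
    split_ifs at hs with h hacc
    · rcases mem_insert.1 hs with rfl | hs
      · exact hacc.1
      · exact ih hs
    · exact ih hs
    · exact ih hs

theorem sum_primalSelect_le (hk : 0 ≤ k) (hx : ∀ s, (x s).Valid) (i : ℕ) :
    ∑ s ∈ primalSelect a₄ S x i, (x s).size ≤ k := by
  induction i with
  | zero => simpa [primalSelect]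
  | succ i ih =>
    rw [primalSelect]
    split_ifs with h hacc
    · rw [sum_insert fun hm => (lt_of_mem_primalSelect a₄ S x i _ hm).false]
      linarith [hacc.2.1, (hx ⟨i, h⟩).2.2]
    · exact ih
    · exact ih

theorem sum_window_primalSelect_le (ha : 0 ≤ a₄ * share n ℓ k) (hx : ∀ s, (x s).Valid) (i j : ℕ) :
    ∑ s ∈ primalSelect a₄ S x i with window ℓ s = j, (x s).size ≤ a₄ * share n ℓ k := by
  induction i with
  | zero => simpa [primalSelect]
  | succ i ih =>
    rw [primalSelect]
    split_ifs with h hacc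
    · rw [filter_insert]
      split_ifs with hj
      · rw [sum_insert fun hm =>
          (lt_of_mem_primalSelect a₄ S x i _ (mem_filter.1 hm).1).false]
        have houter := hacc.2.2
        rw [hj, mul_assoc] at houter
        rw [share]
        linarith [(hx ⟨i, h⟩).2.2]
      · exact ih
    · exact ih
    · exact ih

theorem primalAlg_feasible (hk : 0 ≤ k) : (primalAlg a₄ S).Feasible k :=
  fun _ hx => sum_primalSelect_le hk hx n

theorem mem_select_of_accept {t : Fin n} (h : Accept a₄ S x (primalSelect a₄ S x t) t) :
    t ∈ (primalAlg a₄ S).select x := by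
  change t ∈ primalSelect a₄ S x n
  rw [mem_primalSelect_iff a₄ S x t n t.isLt, primalSelect, dif_pos t.isLt, if_pos h]
  exact mem_insert_self _ _

variable {m : ℕ} {it : Fin m → Item} {cover : Finset ℕ} {K : ℝ} {t : Fin n} {i : ℕ}
  (R : Regime n ℓ m k Γ) (ha : 601 ≤ a₄) (hv : ∀ i, (it i).Valid) (hx : ∀ s, (x s).Valid)
  (hc : #cover ≤ Γ)
  (hW : ∀ s, window ℓ s ∉ cover → k + 1 < load it (x s) → k < ∑ i, topSize it (k + 1) (it i))

include R hv hx hc hW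

theorem Typical.size_eq_topSize_of_mem_primalSelect (hT : Typical 0 ℓ k Γ it cover x) {s : Fin n}
    (hs : s ∈ primalSelect a₄ S x i) (hsc : window ℓ s ∉ cover) :
    (x s).size = topSize it (k + 1) (x s) := by
  obtain ⟨hfeas, hpos⟩ := tentative_of_mem_primalSelect hs
  exact (topSize_of_load_le
    (hT.load_le R hv hx hc (hW s hsc) (S.optimal x s hfeas) hpos)).symm

include ha

theorem TypicalAt.sum_primalSelect_le_sub_one (hT : TypicalAt 0 ℓ k Γ it cover K t x)
    (hlate : (t : ℝ) / n * k + (6 + a₄) * (Γ * share n ℓ k) ≤ k) :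
    ∑ s ∈ primalSelect a₄ S x t, (x s).size ≤ k - 1 := by
  have hk := R.k_ge
  have ha0 : 0 ≤ a₄ * share n ℓ k := mul_nonneg (by linarith) (by linarith [R.one_le_share])
  have hsize := sum_le_mul_add_prefixSize hx hc ha0
    (fun j _ => sum_window_primalSelect_le ha0 hx t j)
    (fun s hs hsc => (hT.size_eq_topSize_of_mem_primalSelect R hv hx hc hW hs hsc).le)
    fun s hs => lt_of_mem_primalSelect a₄ S x t s hs
  have hmean := R.prefixMean_le hv cover (by linarith : 0 ≤ k + 1) (i := t) t.isLt.le
  have htn : (t : ℝ) / n ≤ 1 := div_le_one_of_le₀ (Nat.cast_le.2 t.isLt.le) (Nat.cast_nonneg _)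
  have hexpand : ((t : ℝ) / n + 2 * (Γ * ℓ / n)) * (k + 1) =
      t / n * k + 2 * (Γ * share n ℓ k) + t / n + 2 * (Γ * ℓ / n) := by rw [share]; ring
  linarith [hT.upper_top, R.burst_le, R.share_le, R.one_le_share]

theorem Typical.sum_window_primalSelect_le_sub_one (hT : Typical 0 ℓ k Γ it cover x)
    (ht : window ℓ t ∉ cover) :
    ∑ s ∈ primalSelect a₄ S x i with window ℓ s = window ℓ t, (x s).size ≤
      a₄ * share n ℓ k - 1 := by
  have htop : ∑ s ∈ primalSelect a₄ S x i with window ℓ s = window ℓ t, (x s).size ≤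
      ∑ q with window ℓ q = window ℓ t, topSize it (k + 1) (x q) := by
    refine (sum_le_sum fun s hs => ?_).trans (sum_le_sum_of_subset_of_nonneg
      (filter_subset_filter _ (subset_univ _)) fun s _ _ => topSize_nonneg (hx s) _)
    obtain ⟨hsel, hst⟩ := mem_filter.1 hs
    exact (hT.size_eq_topSize_of_mem_primalSelect R hv hx hc hW hsel (hst ▸ ht)).le
  have hshare := R.one_le_share
  linarith [hT.inner _ (window_mem_range t) ht,
    mul_le_mul_of_nonneg_right ha (zero_le_one.trans hshare)]

theorem TypicalAt.mem_select (hT : TypicalAt 0 ℓ k Γ it cover K t x) (ht : window ℓ t ∉ cover)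
    (hK : 0 ≤ K) (hKt : K * ((t : ℝ) + 1) ≤ k * ((t : ℝ) + 1 - 609 * (Γ * ℓ)))
    (hlate : (t : ℝ) / n * k + (6 + a₄) * (Γ * share n ℓ k) ≤ k)
    (hload : load it (x t) ≤ K) (hval : 0 < (x t).value) :
    t ∈ (primalAlg a₄ S).select x := by
  have hfeas : ∃ X, LPFeasible ℓ k Γ x t X := by
    refine ⟨0, R.zero_lpFeasible x ?_⟩
    have hlarge : 0 ≤ (t : ℝ) + 1 - 609 * (Γ * ℓ) :=
      nonneg_of_mul_nonneg_right ((by positivity : 0 ≤ K * ((t : ℝ) + 1)).trans hKt) R.k_pos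
    linarith [R.burst_pos]
  refine mem_select_of_accept ⟨⟨hfeas, ?_⟩, ?_, ?_⟩
  · exact hT.pos_of_load_le R hv hx hc ht hK hKt hload hval (S.optimal x t hfeas)
  · exact hT.sum_primalSelect_le_sub_one R ha hv hx hc hW hlate
  · rw [mul_assoc]
    exact hT.sum_window_primalSelect_le_sub_one R ha hv hx hc hW ht

end Acceptance

/-! ### Concentration for the random arrival order -/

/-- The parameter in Chernoff's bound for prefixes: optimal for a deviation of about `Γ * share` of
a sum with mean about `k`, up to constants. -/
def tailRate (n ℓ : ℕ) (k Γ : ℝ) : ℝ := Γ * share n ℓ k / (8 * k)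

namespace Regime

variable {n ℓ m : ℕ} {k Γ : ℝ} (R : Regime n ℓ m k Γ)
include R

theorem tailRate_nonneg : 0 ≤ tailRate n ℓ k Γ := by
  have := R.k_pos
  have := R.Γ_ge
  have := R.one_le_share
  unfold tailRate
  positivity

theorem tailRate_le_one : tailRate n ℓ k Γ ≤ 1 := by
  have hk := R.k_pos
  rw [tailRate, div_le_one (by positivity)]
  calc Γ * share n ℓ k = Γ * ℓ / n * k := by rw [share]; ring
    _ ≤ 1 / 2 * k := mul_le_mul_of_nonneg_right R.burst_le hk.le
    _ ≤ 8 * k := by linarith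

theorem tailRate_exponent_le {μ : ℝ} (hμ : μ ≤ k + 1) :
    tailRate n ℓ k Γ ^ 2 * μ - tailRate n ℓ k Γ * (Γ * share n ℓ k - 1) ≤
      -(share n ℓ k ^ 2 / 32) := by
  have hk := R.k_ge
  have hk0 := R.k_pos
  have hΓ : 2 ≤ Γ := le_of_sq_le_sq (by linarith [R.le_sq]) (by linarith [R.Γ_ge])
  have hD : 2 ≤ Γ * share n ℓ k := hΓ.trans
    (le_mul_of_one_le_right (by linarith) R.one_le_share)
  have hρ := R.tailRate_nonneg
  calc tailRate n ℓ k Γ ^ 2 * μ - tailRate n ℓ k Γ * (Γ * share n ℓ k - 1)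
      ≤ tailRate n ℓ k Γ ^ 2 * (2 * k) - tailRate n ℓ k Γ * (Γ * share n ℓ k / 2) := by
        gcongr <;> linarith
    _ = -(Γ ^ 2 * share n ℓ k ^ 2 / k / 32) := by
        rw [tailRate]
        field_simp
        ring
    _ ≤ -(share n ℓ k ^ 2 / 32) := by
        gcongr
        rw [le_div_iff₀ hk0, mul_comm]
        exact mul_le_mul_of_nonneg_right R.le_sq (sq_nonneg _)

theorem card_range_window_le : (#(range (n / ℓ + 1)) : ℝ) ≤ 2 * k := by
  have hℓ : (0 : ℝ) < ℓ := Nat.cast_pos.2 R.ell_pos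
  have hdiv : (n : ℝ) / ℓ ≤ k := by
    rw [div_le_iff₀ hℓ]
    have hshare := R.one_le_share
    rw [share, div_mul_eq_mul_div, le_div_iff₀ R.n_pos] at hshare
    linarith
  rw [card_range]
  push_cast
  linarith [R.k_ge, Nat.cast_div_le (α := ℝ) (m := n) (n := ℓ)]

theorem exp_div_sq : Real.exp 33 / k ^ 2 = Real.exp (33 - 2 * Real.log k) := by
  rw [Real.exp_sub, two_mul, Real.exp_add, Real.exp_log R.k_pos, sq]

theorem exp_neg_two_mul_share_le : Real.exp (-(2 * share n ℓ k)) ≤ Real.exp 33 / k ^ 2 := by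
  rw [R.exp_div_sq, Real.exp_le_exp]
  linarith [R.log_le]

theorem exp_neg_share_sq_le : Real.exp (-(share n ℓ k ^ 2 / 32)) ≤ Real.exp 33 / k ^ 2 := by
  rw [R.exp_div_sq, Real.exp_le_exp]
  linarith [R.log_le, sq_nonneg (share n ℓ k - 32)]

end Regime

namespace Instance

variable {n ℓ : ℕ} {k Γ K : ℝ} {Ω : Type} (B : Instance n ℓ Γ Ω)

theorem mem_RO_of_window_notMem {t : Fin n} (ht : window ℓ t ∉ B.cover) : t ∈ B.RO := by
  by_contra h
  exact ht (B.covers t h)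

theorem mem_RO_of_mem_freePrefix {i : ℕ} {s : Fin n} (hs : s ∈ freePrefix n ℓ B.cover i) :
    s ∈ B.RO :=
  B.mem_RO_of_window_notMem (mem_freePrefix.1 hs).1

theorem mem_RO_of_mem_window {j : ℕ} (hj : j ∉ B.cover) {s : Fin n}
    (hs : s ∈ ({q | window ℓ q = j} : Finset (Fin n))) : s ∈ B.RO :=
  B.mem_RO_of_window_notMem ((mem_filter.1 hs).2 ▸ hj)

theorem arrival_valid (I : {t // t ∈ B.RO} ≃ Fin #B.RO) (ω : Ω) (t : Fin n) :
    (B.arrival I ω t).Valid := by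
  unfold arrival
  split_ifs
  exacts [B.item_valid _, B.adv_valid _ _ _]

section SumArrival

variable (ω : Ω) {φ : Item → ℝ} {F : Finset (Fin n)} (hF : ∀ s ∈ F, s ∈ B.RO)
include hF

theorem sum_arrival (I : {t // t ∈ B.RO} ≃ Fin #B.RO) :
    ∑ s ∈ F, φ (B.arrival I ω s) = ∑ s ∈ F.subtype (· ∈ B.RO), φ (B.item (I s)) := by
  rw [← sum_subtype_of_mem _ hF]
  refine sum_congr rfl fun s _ => ?_
  rw [arrival, dif_pos s.2]

variable (h0 : ∀ y : Item, y.Valid → 0 ≤ φ y) (h1 : ∀ y : Item, y.Valid → φ y ≤ 1)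
include h0 h1

theorem abs_sum_arrival_swap_sub_le (I : {t // t ∈ B.RO} ≃ Fin #B.RO) (a b : {t // t ∈ B.RO}) :
    |∑ s ∈ F, φ (B.arrival ((Equiv.swap a b).trans I) ω s) - ∑ s ∈ F, φ (B.arrival I ω s)| ≤
      1 := by
  rw [B.sum_arrival ω hF, B.sum_arrival ω hF]
  exact abs_sum_swap_sub_le (h := fun s => φ (B.item (I s))) (fun s => h0 _ (B.item_valid _))
    (fun s => h1 _ (B.item_valid _)) _ a b

theorem prob_le_mul_sum_arrival_sub_le {c : ℝ} (hc : |c| ≤ 1) (r : ℝ) :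
    prob (fun I => r ≤ c * (∑ s ∈ F, φ (B.arrival I ω s) - #F * (𝔼 j, φ (B.item j)))) ≤
      Real.exp (c ^ 2 * (#F * (𝔼 j, φ (B.item j))) - r) := by
  have htail := prob_le_mul_sum_sub_le (fun j => h0 _ (B.item_valid j))
    (fun j => h1 _ (B.item_valid j)) (F.subtype (· ∈ B.RO)) hc r
  rw [card_subtype, filter_true_of_mem hF] at htail
  simpa only [B.sum_arrival ω hF] using htail

end SumArrival

theorem expect_topSize_nonneg (K : ℝ) : 0 ≤ 𝔼 j, topSize B.item K (B.item j) :=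
  expect_nonneg fun j _ => topSize_nonneg (B.item_valid j) K

theorem expect_topSize_le (hK : 0 ≤ K) : 𝔼 j, topSize B.item K (B.item j) ≤ K / #B.RO := by
  rw [Fintype.expect_eq_sum_div_card, Fintype.card_fin]
  exact div_le_div_of_nonneg_right (sum_topSize_le B.item_valid hK) (Nat.cast_nonneg _)

theorem abs_prefixSize_swap_sub_le (ω : Ω) (K : ℝ) (i : ℕ) (I : {t // t ∈ B.RO} ≃ Fin #B.RO)
    (a b : {t // t ∈ B.RO}) :
    |prefixSize ℓ B.item B.cover K (B.arrival ((Equiv.swap a b).trans I) ω) i -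
      prefixSize ℓ B.item B.cover K (B.arrival I ω) i| ≤ 1 :=
  B.abs_sum_arrival_swap_sub_le ω (fun _ => B.mem_RO_of_mem_freePrefix)
    (fun _ hy => topSize_nonneg hy K) (fun _ hy => topSize_le_one hy K) I a b

theorem typicalAt_zero_of_swap {ω : Ω} {t : Fin n} {I : {t // t ∈ B.RO} ≃ Fin #B.RO}
    {a b : {t // t ∈ B.RO}}
    (h : TypicalAt 1 ℓ k Γ B.item B.cover K t (B.arrival ((Equiv.swap a b).trans I) ω)) :
    TypicalAt 0 ℓ k Γ B.item B.cover K t (B.arrival I ω) where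
  inner j hj hjc := by
    have hswap := B.abs_sum_arrival_swap_sub_le ω (fun _ => B.mem_RO_of_mem_window hjc)
      (fun _ hy => topSize_nonneg (it := B.item) hy (k + 1))
      (fun _ hy => topSize_le_one hy (k + 1)) I a b
    linarith [(abs_le.1 hswap).1, h.inner j hj hjc]
  lower j hj := by
    linarith [(abs_le.1 (B.abs_prefixSize_swap_sub_le ω (k + 1) (j * ℓ) I a b)).2, h.lower j hj]
  upper := by
    linarith [(abs_le.1 (B.abs_prefixSize_swap_sub_le ω K (t + 1) I a b)).1, h.upper]
  upper_top := by
    linarith [(abs_le.1 (B.abs_prefixSize_swap_sub_le ω (k + 1) t I a b)).1, h.upper_top]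

section Tails

variable (R : Regime n ℓ #B.RO k Γ)
include R

theorem prefixMean_le_size (hK : 0 ≤ K) (i : ℕ) : prefixMean n ℓ B.item B.cover K i ≤ K := by
  have hcard : #(freePrefix n ℓ B.cover i) ≤ #B.RO :=
    card_le_card fun _ => B.mem_RO_of_mem_freePrefix
  calc #(freePrefix n ℓ B.cover i) * (𝔼 j, topSize B.item K (B.item j))
      ≤ (#B.RO : ℝ) * (K / #B.RO) :=
        mul_le_mul (Nat.cast_le.2 hcard) (B.expect_topSize_le hK) (B.expect_topSize_nonneg K)
          (Nat.cast_nonneg _)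
    _ = K := mul_div_cancel₀ _ R.m_pos.ne'

theorem prob_prefixSize_deviation_le (ω : Ω) (hK : 0 ≤ K) (hKk : K ≤ k + 1) (i : ℕ) {c : ℝ}
    (hc : |c| = tailRate n ℓ k Γ) :
    prob (fun I => tailRate n ℓ k Γ * (Γ * share n ℓ k - 1) ≤
      c * (prefixSize ℓ B.item B.cover K (B.arrival I ω) i -
        prefixMean n ℓ B.item B.cover K i)) ≤ Real.exp 33 / k ^ 2 := by
  refine (B.prob_le_mul_sum_arrival_sub_le ω (fun _ => B.mem_RO_of_mem_freePrefix)
    (fun _ hy => topSize_nonneg hy K) (fun _ hy => topSize_le_one hy K)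
    (hc.trans_le R.tailRate_le_one) _).trans ?_
  refine (Real.exp_le_exp.2 ?_).trans R.exp_neg_share_sq_le
  rw [← sq_abs, hc]
  exact R.tailRate_exponent_le ((B.prefixMean_le_size R hK i).trans hKk)

theorem prob_prefixSize_gt_le (ω : Ω) (hK : 0 ≤ K) (hKk : K ≤ k + 1) (i : ℕ) :
    prob (fun I => ¬ prefixSize ℓ B.item B.cover K (B.arrival I ω) i ≤
      prefixMean n ℓ B.item B.cover K i + (Γ * share n ℓ k - 1)) ≤ Real.exp 33 / k ^ 2 := by
  refine (prob_mono fun I hI => ?_).trans (B.prob_prefixSize_deviation_le R ω hK hKk i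
    (abs_of_nonneg R.tailRate_nonneg))
  exact mul_le_mul_of_nonneg_left (by linarith) R.tailRate_nonneg

theorem prob_prefixSize_lt_le (ω : Ω) (hK : 0 ≤ K) (hKk : K ≤ k + 1) (i : ℕ) :
    prob (fun I => ¬ prefixMean n ℓ B.item B.cover K i - (Γ * share n ℓ k - 1) ≤
      prefixSize ℓ B.item B.cover K (B.arrival I ω) i) ≤ Real.exp 33 / k ^ 2 := by
  refine (prob_mono fun I hI => ?_).trans (B.prob_prefixSize_deviation_le R ω hK hKk i
    ((abs_neg _).trans (abs_of_nonneg R.tailRate_nonneg)))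
  rw [neg_mul, ← mul_neg]
  exact mul_le_mul_of_nonneg_left (by linarith) R.tailRate_nonneg

theorem prob_window_gt_le (ω : Ω) {j : ℕ} (hj : j ∉ B.cover) :
    prob (fun I => ¬ ∑ q with window ℓ q = j, topSize B.item (k + 1) (B.arrival I ω q) ≤
      600 * share n ℓ k - 1) ≤ Real.exp 33 / k ^ 2 := by
  have hk := R.k_ge
  have hmean : #{s : Fin n | window ℓ s = j} * (𝔼 j, topSize B.item (k + 1) (B.item j)) ≤
      4 * share n ℓ k := by
    calc (#{s : Fin n | window ℓ s = j} : ℝ) * (𝔼 j, topSize B.item (k + 1) (B.item j))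
        ≤ ℓ * ((k + 1) / #B.RO) :=
          mul_le_mul (Nat.cast_le.2 (card_window_le R.ell_pos j))
            (B.expect_topSize_le (by linarith)) (B.expect_topSize_nonneg _) (Nat.cast_nonneg _)
      _ ≤ ℓ * (2 * k / (n / 2)) := by
          have hn := R.n_pos
          gcongr
          · linarith
          · linarith [R.n_le_two_mul]
      _ = 4 * share n ℓ k := by rw [share]; ring
  have htail := B.prob_le_mul_sum_arrival_sub_le ω (fun _ => B.mem_RO_of_mem_window hj)
    (fun _ hy => topSize_nonneg (it := B.item) hy (k + 1)) (fun _ hy => topSize_le_one hy (k + 1))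
    (abs_one (α := ℝ)).le (596 * share n ℓ k - 1)
  refine (prob_mono fun I hI => ?_).trans (htail.trans ?_)
  · linarith
  · refine (Real.exp_le_exp.2 ?_).trans R.exp_neg_two_mul_share_le
    linarith [R.one_le_share]

theorem prob_exists_window_gt_le (ω : Ω) :
    prob (fun I => ∃ j ∈ range (n / ℓ + 1), ¬ (j ∉ B.cover →
      ∑ q with window ℓ q = j, topSize B.item (k + 1) (B.arrival I ω q) ≤
        600 * share n ℓ k - 1)) ≤ 2 * k * (Real.exp 33 / k ^ 2) := by
  refine (prob_exists_le _ _ (c := Real.exp 33 / k ^ 2) fun j _ => ?_).trans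
    (mul_le_mul_of_nonneg_right R.card_range_window_le (by positivity))
  by_cases hj : j ∈ B.cover
  · simpa [hj, prob] using (by positivity : 0 ≤ Real.exp 33 / k ^ 2)
  · simpa only [hj, not_false_eq_true, true_imp_iff] using B.prob_window_gt_le R ω hj

theorem prob_exists_prefixSize_lt_le (ω : Ω) :
    prob (fun I => ∃ j ∈ range (n / ℓ + 1), ¬
      prefixMean n ℓ B.item B.cover (k + 1) (j * ℓ) - (Γ * share n ℓ k - 1) ≤
        prefixSize ℓ B.item B.cover (k + 1) (B.arrival I ω) (j * ℓ)) ≤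
      2 * k * (Real.exp 33 / k ^ 2) :=
  (prob_exists_le _ _ fun j _ =>
    B.prob_prefixSize_lt_le R ω (by linarith [R.k_ge]) le_rfl (j * ℓ)).trans
    (mul_le_mul_of_nonneg_right R.card_range_window_le (by positivity))

theorem prob_not_typicalAt_le (ω : Ω) (hK : 0 ≤ K) (hKk : K ≤ k) (t : Fin n) :
    prob (fun I => ¬ TypicalAt 1 ℓ k Γ B.item B.cover K t (B.arrival I ω)) ≤
      10 * Real.exp 33 / k := by
  have hk := R.k_ge
  refine (prob_mono (q := fun I => ((∃ j ∈ range (n / ℓ + 1), ¬ (j ∉ B.cover → _)) ∨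
    ∃ j ∈ range (n / ℓ + 1), ¬ _) ∨ (¬ _ ∨ ¬ _)) fun I hI => ?_).trans <|
    (prob_or_le _ _).trans <| (add_le_add ((prob_or_le _ _).trans (add_le_add
      (B.prob_exists_window_gt_le R ω) (B.prob_exists_prefixSize_lt_le R ω)))
      ((prob_or_le _ _).trans (add_le_add
        (B.prob_prefixSize_gt_le R ω hK (by linarith) (t + 1))
        (B.prob_prefixSize_gt_le R ω (by linarith) le_rfl t)))).trans ?_
  · contrapose! hI
    exact ⟨⟨hI.1.1, hI.1.2⟩, hI.2.1, hI.2.2⟩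
  · calc 2 * k * (Real.exp 33 / k ^ 2) + 2 * k * (Real.exp 33 / k ^ 2) +
          (Real.exp 33 / k ^ 2 + Real.exp 33 / k ^ 2)
        = (4 * k + 2) * (Real.exp 33 / k ^ 2) := by ring
      _ ≤ 10 * k * (Real.exp 33 / k ^ 2) := by gcongr; linarith
      _ = 10 * Real.exp 33 / k := by field_simp

theorem one_sub_le_card_mul_prob_typicalAt (ω : Ω) (hK : 0 ≤ K) (hKk : K ≤ k)
    (t : {t // t ∈ B.RO}) (i : Fin #B.RO) :
    1 - 10 * Real.exp 33 / k ≤ #B.RO * prob fun I =>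
      I t = i ∧ TypicalAt 0 ℓ k Γ B.item B.cover K t (B.arrival I ω) := by
  have : Nonempty ({t // t ∈ B.RO} ≃ Fin #B.RO) := ⟨B.RO.equivFin⟩
  calc 1 - 10 * Real.exp 33 / k
      ≤ prob fun I => TypicalAt 1 ℓ k Γ B.item B.cover K t (B.arrival I ω) :=
        (sub_le_sub_left (B.prob_not_typicalAt_le R ω hK hKk t) 1).trans (one_sub_prob_not_le _)
    _ ≤ _ := by
        simpa only [Fintype.card_coe] using
          prob_le_card_mul_prob_apply_eq t i fun I b => B.typicalAt_zero_of_swap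

end Tails

end Instance

/-! ### The expected value of the primal algorithm -/

theorem card_filter_succ_lt_le (n : ℕ) {r : ℝ} (hr : 0 ≤ r) :
    (#{t : Fin n | (t : ℝ) + 1 < r} : ℝ) ≤ r := by
  have hfloor : #{t : Fin n | (t : ℝ) + 1 < r} ≤ ⌊r⌋₊ := by
    refine (card_le_card (t := {t : Fin n | (t : ℕ) < ⌊r⌋₊}) fun t ht => ?_).trans ?_
    · rw [mem_filter] at ht ⊢
      exact ⟨mem_univ _, Nat.le_floor (by push_cast; exact ht.2.le)⟩
    · rw [Fin.card_filter_val_lt]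
      exact min_le_right _ _
  exact (Nat.cast_le.2 hfloor).trans (Nat.floor_le hr)

theorem card_filter_lt_add_le (n : ℕ) {r : ℝ} (hr : 0 ≤ r) :
    (#{t : Fin n | (n : ℝ) < t + r} : ℝ) ≤ r := by
  refine le_trans ?_ (card_filter_succ_lt_le n hr)
  refine Nat.cast_le.2 (card_le_card_of_injOn Fin.rev (fun t ht => ?_) Fin.rev_injective.injOn)
  have hlast := (mem_filter.1 (mem_coe.1 ht)).2
  have hrev : ((Fin.rev t : Fin n) : ℝ) + 1 + t = n := by
    have hval := Fin.val_rev t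
    exact_mod_cast (by omega : (Fin.rev t : ℕ) + 1 + t = n)
  exact mem_coe.2 (mem_filter.2 ⟨mem_univ _, by linarith⟩)

theorem sum_inv_succ_le {n : ℕ} {r : ℝ} (hr : 1 ≤ r) (hrn : r ≤ n) :
    ∑ t ∈ ({t | r ≤ (t : ℝ) + 1} : Finset (Fin n)), 1 / ((t : ℝ) + 1) ≤ 1 + Real.log (n / r) := by
  have hr0 : 0 < r := by linarith
  rw [sum_filter]
  induction n with
  | zero => norm_num at hrn; linarith
  | succ n ih =>
    rw [Fin.sum_univ_castSucc]
    simp only [Fin.val_castSucc, Fin.val_last]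
    push_cast at hrn ⊢
    rw [if_pos hrn]
    rcases le_or_gt r n with hn | hn
    · have hn0 : (0 : ℝ) < n := hr0.trans_le hn
      have hstep := Real.one_sub_inv_le_log_of_pos (x := ((n : ℝ) + 1) / n) (by positivity)
      have hinv : 1 - (((n : ℝ) + 1) / n)⁻¹ = 1 / ((n : ℝ) + 1) := by field_simp; ring
      have hlog : Real.log (((n : ℝ) + 1) / r) = Real.log (((n : ℝ) + 1) / n) +
          Real.log (n / r) := by
        rw [← Real.log_mul (by positivity) (by positivity), div_mul_div_cancel₀ hn0.ne']
      linarith [ih hn]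
    · rw [sum_eq_zero fun t _ => if_neg ?_, zero_add]
      · have hlog := Real.log_nonneg ((one_le_div hr0).2 hrn)
        have hone : 1 / ((n : ℝ) + 1) ≤ 1 := div_le_one_of_le₀ (by linarith) (by linarith)
        linarith
      · have ht : (t : ℝ) + 1 ≤ n := by exact_mod_cast t.isLt
        linarith

/-- The free times at which the analysis bounds the collected value from below: late enough for the
budget of the linear program to cover the densest items, early enough for the algorithm not to
have exhausted its knapsack. -/
def goodTimes (n ℓ : ℕ) (Γ a₄ : ℝ) (cover : Finset ℕ) : Finset (Fin n) :=
  {t | window ℓ t ∉ cover ∧ 609 * (Γ * ℓ) ≤ (t : ℝ) + 1 ∧ (t : ℝ) + (6 + a₄) * (Γ * ℓ) ≤ n}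

theorem mem_goodTimes {n ℓ : ℕ} {Γ a₄ : ℝ} {cover : Finset ℕ} {t : Fin n} :
    t ∈ goodTimes n ℓ Γ a₄ cover ↔ window ℓ t ∉ cover ∧ 609 * (Γ * ℓ) ≤ (t : ℝ) + 1 ∧
      (t : ℝ) + (6 + a₄) * (Γ * ℓ) ≤ n := by
  simp [goodTimes]

/-- The constant in the error term of the primal algorithm. -/
def primalConst (a₄ : ℝ) : ℝ := 2 * (1226 + a₄ + 10 * Real.exp 33) + 609

theorem primalConst_nonneg {a₄ : ℝ} (ha : 0 ≤ a₄) : 0 ≤ primalConst a₄ := by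
  unfold primalConst
  positivity

namespace Regime

variable {n ℓ m : ℕ} {k Γ a₄ : ℝ} (R : Regime n ℓ m k Γ) {cover : Finset ℕ}
include R

theorem one_le_burst : 1 ≤ Γ * ℓ :=
  one_le_mul_of_one_le_of_one_le R.Γ_ge (Nat.one_le_cast.2 R.ell_pos)

theorem burst_le_n : Γ * ℓ ≤ n := by
  have hburst := R.burst_le
  rw [div_le_iff₀ R.n_pos] at hburst
  linarith [R.n_pos]

theorem sub_le_card_goodTimes (ha : 0 ≤ a₄) (hc : #cover ≤ Γ) :
    n - (616 + a₄) * (Γ * ℓ) ≤ #(goodTimes n ℓ Γ a₄ cover) := by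
  have hb := R.burst_pos
  have hunion : #(univ : Finset (Fin n)) ≤ #{t : Fin n | window ℓ t ∈ cover} +
      #{t : Fin n | (t : ℝ) + 1 < 609 * (Γ * ℓ)} +
        #{t : Fin n | (n : ℝ) < t + (6 + a₄) * (Γ * ℓ)} + #(goodTimes n ℓ Γ a₄ cover) := by
    refine (card_le_card fun t _ => ?_).trans ((card_union_le _ _).trans (Nat.add_le_add_right
      ((card_union_le _ _).trans (Nat.add_le_add_right (card_union_le _ _) _)) _))
    simp only [mem_goodTimes, mem_union, mem_filter, mem_univ, true_and, ← not_le]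
    tauto
  rw [card_univ, Fintype.card_fin, ← Nat.cast_le (α := ℝ)] at hunion
  push_cast at hunion
  have hcovered : (#{t : Fin n | window ℓ t ∈ cover} : ℝ) ≤ Γ * ℓ :=
    (by exact_mod_cast card_covered_le R.ell_pos cover :
      (#{t : Fin n | window ℓ t ∈ cover} : ℝ) ≤ #cover * ℓ).trans
      (mul_le_mul_of_nonneg_right hc (Nat.cast_nonneg _))
  have hearly := card_filter_succ_lt_le n (r := 609 * (Γ * ℓ)) (by positivity)
  have hlate := card_filter_lt_add_le n (r := (6 + a₄) * (Γ * ℓ)) (by positivity)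
  linarith

theorem sum_goodTimes_inv_succ_le :
    ∑ t ∈ goodTimes n ℓ Γ a₄ cover, 1 / ((t : ℝ) + 1) ≤ 1 + Real.log (n / (Γ * ℓ)) := by
  refine (sum_le_sum_of_subset_of_nonneg (fun t ht => ?_) fun t _ _ => by positivity).trans
    (sum_inv_succ_le R.one_le_burst R.burst_le_n)
  exact mem_filter.2 ⟨mem_univ _, by linarith [(mem_goodTimes.1 ht).2.1, R.burst_pos]⟩

theorem mul_one_sub_le_sum_goodTimes (ha : 0 ≤ a₄) (hc : #cover ≤ Γ) :
    n * (1 - ((1225 + a₄) * (Γ * ℓ / n) + 1 / k +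
      609 * (Γ * ℓ / n * Real.log (n / (Γ * ℓ))))) ≤
      ∑ t ∈ goodTimes n ℓ Γ a₄ cover, (1 - 609 * (Γ * ℓ) * (1 / ((t : ℝ) + 1)) - 1 / k) := by
  have hn := R.n_pos
  have hk := R.k_pos
  rw [sum_sub_distrib, sum_sub_distrib, ← mul_sum, sum_const, sum_const, nsmul_eq_mul,
    nsmul_eq_mul, mul_one]
  have hharmonic := mul_le_mul_of_nonneg_left
    (R.sum_goodTimes_inv_succ_le (a₄ := a₄) (cover := cover))
    (by linarith [R.burst_pos] : 0 ≤ 609 * (Γ * ℓ))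
  have hcard : (#(goodTimes n ℓ Γ a₄ cover) : ℝ) * (1 / k) ≤ n * (1 / k) := by
    refine mul_le_mul_of_nonneg_right (Nat.cast_le.2 ?_) (by positivity)
    simpa using card_le_univ (goodTimes n ℓ Γ a₄ cover)
  have hexpand : (n : ℝ) * (1 - ((1225 + a₄) * (Γ * ℓ / n) + 1 / k +
      609 * (Γ * ℓ / n * Real.log (n / (Γ * ℓ))))) =
      n - (1225 + a₄) * (Γ * ℓ) - n * (1 / k) - 609 * (Γ * ℓ) * Real.log (n / (Γ * ℓ)) := by
    field_simp
    ring
  linarith [R.sub_le_card_goodTimes ha hc]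

theorem total_loss_le (ha : 0 ≤ a₄) :
    (1225 + a₄) * (Γ * ℓ / n) + 1 / k + 609 * (Γ * ℓ / n * Real.log (n / (Γ * ℓ))) +
      10 * Real.exp 33 / k ≤ primalConst a₄ * (Γ * ℓ / n * Real.log (n / (Γ * ℓ))) := by
  have hb : 0 ≤ Γ * ℓ / n := div_nonneg R.burst_pos.le R.n_pos.le
  have hlog : Γ * ℓ / n ≤ 2 * (Γ * ℓ / n * Real.log (n / (Γ * ℓ))) := by
    linarith [mul_le_mul_of_nonneg_left R.log_ge hb]
  calc (1225 + a₄) * (Γ * ℓ / n) + 1 / k + 609 * (Γ * ℓ / n * Real.log (n / (Γ * ℓ))) +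
        10 * Real.exp 33 / k
      = (1225 + a₄) * (Γ * ℓ / n) + (1 + 10 * Real.exp 33) * (1 / k) +
          609 * (Γ * ℓ / n * Real.log (n / (Γ * ℓ))) := by ring
    _ ≤ (1225 + a₄) * (Γ * ℓ / n) + (1 + 10 * Real.exp 33) * (Γ * ℓ / n) +
          609 * (Γ * ℓ / n * Real.log (n / (Γ * ℓ))) := by
        gcongr _ + _ * ?_ + _
        exact R.inv_le
    _ = (1226 + a₄ + 10 * Real.exp 33) * (Γ * ℓ / n) +
          609 * (Γ * ℓ / n * Real.log (n / (Γ * ℓ))) := by ring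
    _ ≤ (1226 + a₄ + 10 * Real.exp 33) * (2 * (Γ * ℓ / n * Real.log (n / (Γ * ℓ)))) +
          609 * (Γ * ℓ / n * Real.log (n / (Γ * ℓ))) := by
        gcongr
    _ = primalConst a₄ * (Γ * ℓ / n * Real.log (n / (Γ * ℓ))) := by
        rw [primalConst]
        ring

end Regime

namespace Instance

variable {n ℓ : ℕ} {k K Γ a₄ : ℝ} {Ω : Type} (B : Instance n ℓ Γ Ω)

section Opt

theorem optRO_nonneg (k : ℝ) : 0 ≤ B.optRO k := by
  refine Real.sSup_nonneg ?_
  rintro r ⟨X, hX, _, rfl⟩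
  exact sum_nonneg fun i _ => mul_nonneg (B.item_valid i).1 (hX i).1

theorem optRO_le (hk : 0 ≤ k) {c : ℝ}
    (h : ∀ X : Fin #B.RO → ℝ, (∀ i, 0 ≤ X i ∧ X i ≤ 1) →
      ∑ i, (B.item i).size * X i ≤ k → ∑ i, (B.item i).value * X i ≤ c) : B.optRO k ≤ c := by
  refine csSup_le ⟨0, 0, fun i => ⟨le_rfl, zero_le_one⟩, by simpa using hk, by simp⟩ ?_
  rintro r ⟨X, hX, hXk, rfl⟩
  exact h X hX hXk

theorem le_optRO {X : Fin #B.RO → ℝ} (hX : ∀ i, 0 ≤ X i ∧ X i ≤ 1)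
    (hXk : ∑ i, (B.item i).size * X i ≤ k) : ∑ i, (B.item i).value * X i ≤ B.optRO k := by
  refine le_csSup ⟨∑ i, (B.item i).value, ?_⟩ ⟨X, hX, hXk, rfl⟩
  rintro r ⟨Y, hY, _, rfl⟩
  exact sum_le_sum fun i _ => mul_le_of_le_one_right (B.item_valid i).1 (hY i).2

variable {B}

theorem DistinctDensities.injOn_density (hd : B.DistinctDensities) :
    Set.InjOn (fun i => (B.item i).density) {i | 0 < (B.item i).size} := fun i hi j hj hij => by
  by_contra hne
  exact hd i j hne hi hj hij

theorem DistinctDensities.mul_optRO_le (hd : B.DistinctDensities) (hK : 0 ≤ K) (hKk : K ≤ k) :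
    (K - 1) * B.optRO k ≤ k * ∑ i ∈ topItems B.item K, (B.item i).value := by
  rcases le_or_gt K 1 with hK1 | hK1
  · exact (mul_nonpos_of_nonpos_of_nonneg (by linarith) (B.optRO_nonneg k)).trans
      (mul_nonneg (hK.trans hKk) (sum_nonneg fun i _ => (B.item_valid i).1))
  · rw [← le_div_iff₀' (by linarith)]
    refine B.optRO_le (hK.trans hKk) fun X hX hXk => ?_
    rw [le_div_iff₀' (by linarith)]
    exact mul_sum_value_le B.item_valid hd.injOn_density hK hKk hX hXk

theorem DistinctDensities.lt_sum_topSize (hd : B.DistinctDensities) (hK : 0 ≤ K)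
    (h : ∃ i, K < load B.item (B.item i)) : K - 1 < ∑ i, topSize B.item K (B.item i) := by
  obtain ⟨_, _, _, _, hsize⟩ := exists_density_threshold B.item_valid hd.injOn_density hK h
  rwa [sum_topSize]

end Opt

section Expectation

variable [Fintype Ω] (A : Ω → OnlineAlg n)

theorem expectedValue_nonneg : 0 ≤ B.expectedValue A :=
  expect_nonneg fun ω _ => expect_nonneg fun I _ => sum_nonneg fun t _ =>
    (B.arrival_valid I ω t).1

theorem le_expectedValue [Nonempty Ω] {F : Finset (Fin n)} (hF : ∀ t ∈ F, window ℓ t ∉ B.cover)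
    {c : ℝ} (h : ∀ ω, c ≤ ∑ t ∈ F, 𝔼 I : {t // t ∈ B.RO} ≃ Fin #B.RO,
      if t ∈ (A ω).select (B.arrival I ω) then (B.arrival I ω t).value else 0) :
    c ≤ B.expectedValue A := by
  rw [← Fintype.expect_const (ι := Ω) c]
  refine expect_le_expect fun ω _ => (h ω).trans ?_
  rw [← expect_sum_comm]
  refine expect_le_expect fun I _ => ?_
  rw [sum_filter]
  refine sum_le_sum_of_subset_of_nonneg (fun t ht => B.mem_RO_of_window_notMem (hF t ht))
    fun t _ _ => ?_
  split_ifs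
  exacts [(B.arrival_valid I ω t).1, le_rfl]

end Expectation

section PrimalValue

variable {B} (R : Regime n ℓ #B.RO k Γ) (hd : B.DistinctDensities) (ha : 601 ≤ a₄)
  (S : LPSolver n ℓ k Γ) (ω : Ω) {t : Fin n}
include R hd ha

section Time

variable (ht : window ℓ t ∉ B.cover) (hK : 0 ≤ K)
  (hKt : K * ((t : ℝ) + 1) ≤ k * ((t : ℝ) + 1 - 609 * (Γ * ℓ)))
  (hlate : (t : ℝ) / n * k + (6 + a₄) * (Γ * share n ℓ k) ≤ k)
include ht hK hKt hlate

theorem mem_select_of_typicalAt {I : {t // t ∈ B.RO} ≃ Fin #B.RO}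
    (hT : TypicalAt 0 ℓ k Γ B.item B.cover K t (B.arrival I ω))
    (hload : load B.item (B.arrival I ω t) ≤ K) (hval : 0 < (B.arrival I ω t).value) :
    t ∈ (primalAlg a₄ S).select (B.arrival I ω) := by
  refine hT.mem_select R ha B.item_valid (B.arrival_valid I ω) B.card_cover (fun s hs hs' => ?_)
    ht hK hKt hlate hload hval
  rw [arrival, dif_pos (B.mem_RO_of_window_notMem hs)] at hs'
  linarith [hd.lt_sum_topSize (by linarith [R.k_pos] : 0 ≤ k + 1) ⟨_, hs'⟩]

open Classical in
theorem sum_topItems_ite_le (I : {t // t ∈ B.RO} ≃ Fin #B.RO) :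
    ∑ i ∈ topItems B.item K, (if I ⟨t, B.mem_RO_of_window_notMem ht⟩ = i ∧
      TypicalAt 0 ℓ k Γ B.item B.cover K t (B.arrival I ω) then (B.item i).value else 0) ≤
      if t ∈ (primalAlg a₄ S).select (B.arrival I ω) then (B.arrival I ω t).value else 0 := by
  set i₀ := I ⟨t, B.mem_RO_of_window_notMem ht⟩
  have harrival : B.arrival I ω t = B.item i₀ := by
    rw [arrival, dif_pos (B.mem_RO_of_window_notMem ht)]
  have hval : 0 ≤ (B.arrival I ω t).value := (B.arrival_valid I ω t).1
  have hcollected : 0 ≤ if t ∈ (primalAlg a₄ S).select (B.arrival I ω) then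
      (B.arrival I ω t).value else 0 := by
    split_ifs
    exacts [hval, le_rfl]
  simp only [ite_and, sum_ite_eq]
  split_ifs with htop hT hsel hsel
  · rw [harrival]
  · rw [← harrival]
    by_contra! hpos
    exact hsel (mem_select_of_typicalAt R hd ha S ω ht hK hKt hlate hT
      (harrival ▸ mem_topItems.1 htop) hpos)
  all_goals first | exact hval | exact le_rfl

theorem le_expect_collected (hKk : K ≤ k) :
    (1 - 10 * Real.exp 33 / k) / #B.RO * ∑ i ∈ topItems B.item K, (B.item i).value ≤
      𝔼 I : {t // t ∈ B.RO} ≃ Fin #B.RO,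
        if t ∈ (primalAlg a₄ S).select (B.arrival I ω) then (B.arrival I ω t).value else 0 := by
  classical
  refine le_trans ?_ (expect_le_expect fun I _ =>
    sum_topItems_ite_le R hd ha S ω ht hK hKt hlate I)
  rw [expect_sum_comm, mul_sum]
  refine sum_le_sum fun i _ => ?_
  have hprob := (div_le_iff₀' R.m_pos).2 <|
    B.one_sub_le_card_mul_prob_typicalAt R ω hK hKk ⟨t, B.mem_RO_of_window_notMem ht⟩ i
  refine (mul_le_mul_of_nonneg_right hprob (B.item_valid i).1).trans_eq ?_
  rw [prob, expect_mul]
  simp only [ite_mul, one_mul, zero_mul]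

end Time

theorem mul_optRO_le_expect_collected (hk : 10 * Real.exp 33 ≤ k)
    (ht : t ∈ goodTimes n ℓ Γ a₄ B.cover) :
    (1 - 10 * Real.exp 33 / k) / n *
      ((1 - 609 * (Γ * ℓ) * (1 / ((t : ℝ) + 1)) - 1 / k) * B.optRO k) ≤
      𝔼 I : {t // t ∈ B.RO} ≃ Fin #B.RO,
        if t ∈ (primalAlg a₄ S).select (B.arrival I ω) then (B.arrival I ω t).value else 0 := by
  obtain ⟨hfree, hearly, hlate⟩ := mem_goodTimes.1 ht
  have ht0 : (0 : ℝ) < (t : ℝ) + 1 := by positivity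
  have hk0 := R.k_pos
  have hn := R.n_pos
  set K := k * (1 - 609 * (Γ * ℓ) * (1 / ((t : ℝ) + 1))) with hKdef
  have hK : 0 ≤ K := by
    refine mul_nonneg hk0.le (sub_nonneg.2 ?_)
    rwa [mul_one_div, div_le_one ht0]
  have hKk : K ≤ k := by
    have := R.burst_pos
    exact mul_le_of_le_one_right hk0.le (sub_le_self _ (by positivity))
  have hδ : 0 ≤ 1 - 10 * Real.exp 33 / k := sub_nonneg.2 ((div_le_one hk0).2 hk)
  have hV : 0 ≤ ∑ i ∈ topItems B.item K, (B.item i).value :=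
    sum_nonneg fun i _ => (B.item_valid i).1
  have hopt : (1 - 609 * (Γ * ℓ) * (1 / ((t : ℝ) + 1)) - 1 / k) * B.optRO k ≤
      ∑ i ∈ topItems B.item K, (B.item i).value := by
    rw [show (1 - 609 * (Γ * ℓ) * (1 / ((t : ℝ) + 1)) - 1 / k) * B.optRO k =
      (K - 1) * B.optRO k / k by rw [hKdef]; field_simp, div_le_iff₀' hk0]
    exact hd.mul_optRO_le hK hKk
  calc _ ≤ (1 - 10 * Real.exp 33 / k) / n * ∑ i ∈ topItems B.item K, (B.item i).value :=
        mul_le_mul_of_nonneg_left hopt (div_nonneg hδ hn.le)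
    _ ≤ (1 - 10 * Real.exp 33 / k) / #B.RO * ∑ i ∈ topItems B.item K, (B.item i).value :=
        mul_le_mul_of_nonneg_right (div_le_div_of_nonneg_left hδ R.m_pos
          (Nat.cast_le.2 R.m_le)) hV
    _ ≤ _ := by
        refine le_expect_collected R hd ha S ω hfree hK (le_of_eq ?_) ?_ hKk
        · rw [hKdef]
          field_simp
        · rw [share, show (t : ℝ) / n * k + (6 + a₄) * (Γ * (ℓ / n * k)) =
            ((t : ℝ) + (6 + a₄) * (Γ * ℓ)) / n * k by ring]
          exact mul_le_of_le_one_left hk0.le ((div_le_one hn).2 hlate)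

theorem le_expectedValue_primalAlg [Fintype Ω] [Nonempty Ω] :
    (1 - primalConst a₄ * (Γ * ℓ / n * Real.log (n / (Γ * ℓ)))) * B.optRO k ≤
      B.expectedValue fun _ => primalAlg a₄ S := by
  have hOPT := B.optRO_nonneg k
  have hk0 := R.k_pos
  have hn := R.n_pos
  have ha0 : 0 ≤ a₄ := by linarith
  set δ := 10 * Real.exp 33 / k
  set y := (1225 + a₄) * (Γ * ℓ / n) + 1 / k + 609 * (Γ * ℓ / n * Real.log (n / (Γ * ℓ)))
  have hδ0 : 0 ≤ δ := by positivity
  have hy0 : 0 ≤ y := by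
    have := R.burst_pos
    have := R.log_ge
    positivity
  have hloss := R.total_loss_le ha0
  rcases lt_or_ge k (10 * Real.exp 33) with hk | hk
  · have hδ1 : 1 < δ := (one_lt_div hk0).2 hk
    exact (mul_nonpos_of_nonpos_of_nonneg (by linarith) hOPT).trans (B.expectedValue_nonneg _)
  have hprod : 1 - primalConst a₄ * (Γ * ℓ / n * Real.log (n / (Γ * ℓ))) ≤ (1 - δ) * (1 - y) := by
    linarith [mul_nonneg hδ0 hy0]
  refine (mul_le_mul_of_nonneg_right hprod hOPT).trans ?_
  refine B.le_expectedValue _ (fun t ht => (mem_goodTimes.1 ht).1) fun ω => le_trans ?_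
    (sum_le_sum fun t ht => mul_optRO_le_expect_collected R hd ha S ω hk ht)
  rw [← mul_sum, ← sum_mul]
  have hδ1 : 0 ≤ (1 - δ) / n := div_nonneg (sub_nonneg.2 ((div_le_one hk0).2 hk)) hn.le
  calc (1 - δ) * (1 - y) * B.optRO k = (1 - δ) / n * (n * (1 - y) * B.optRO k) := by field_simp
    _ ≤ _ := mul_le_mul_of_nonneg_left (mul_le_mul_of_nonneg_right
        (R.mul_one_sub_le_sum_goodTimes ha0 B.card_cover) hOPT) hδ1

end PrimalValue

end Instance

section Parameters

variable {n ℓ : ℕ} {k Γ : ℝ}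

theorem three_le_log (hk : 80 ≤ k) : 3 ≤ Real.log k := by
  rw [Real.le_log_iff_exp_le (by linarith)]
  calc Real.exp 3 = Real.exp 1 ^ 3 := by rw [← Real.exp_nat_mul]; norm_num
    _ ≤ 2.72 ^ 3 := by
        gcongr
        linarith [Real.exp_one_lt_d9]
    _ ≤ k := le_trans (by norm_num) hk

theorem abs_share_sub_log_le (hk : 0 < k) (hkn : k ≤ (n : ℝ) / 2)
    (hℓ : |(ℓ : ℝ) - n * Real.log k / k| < 1) : |share n ℓ k - Real.log k| ≤ 1 / 2 := by
  have hn : (0 : ℝ) < n := by linarith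
  calc |share n ℓ k - Real.log k| = |(ℓ - n * Real.log k / k) * (k / n)| := by
        rw [share]
        congr 1
        field_simp
    _ = |(ℓ : ℝ) - n * Real.log k / k| * (k / n) := by
        rw [abs_mul, abs_of_pos (div_pos hk hn)]
    _ ≤ 1 * (1 / 2) := by
        refine mul_le_mul hℓ.le ?_ (by positivity) zero_le_one
        rw [div_le_iff₀ hn]
        linarith
    _ = 1 / 2 := one_mul _

variable (hk : 80 ≤ k) (hkn : k ≤ (n : ℝ) / 2) (hℓ : |(ℓ : ℝ) - n * Real.log k / k| < 1)
  (hΓ : Real.sqrt k ≤ Γ) (hb : Γ * ℓ / n ≤ 1 / 2)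
include hk hkn hℓ

theorem ell_pos_of_abs_sub_lt : 0 < ℓ := by
  refine Nat.pos_of_ne_zero fun h => ?_
  have hshare := (abs_le.1 (abs_share_sub_log_le (by linarith) hkn hℓ)).1
  rw [h, share, Nat.cast_zero, zero_div, zero_mul] at hshare
  linarith [three_le_log hk]

include hΓ hb

theorem regime_of_params {m : ℕ} (hm : m ≤ n) (hnm : (n : ℝ) ≤ m + Γ * ℓ) :
    Regime n ℓ m k Γ := by
  have hlog := three_le_log hk
  obtain ⟨hlower, hupper⟩ := abs_le.1 (abs_share_sub_log_le (by linarith) hkn hℓ)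
  have hsqrt : 1 ≤ Real.sqrt k := Real.one_le_sqrt.2 (by linarith)
  exact
    { k_ge := hk
      k_le := hkn
      ell_pos := ell_pos_of_abs_sub_lt hk hkn hℓ
      one_le_share := by linarith
      Γ_ge := hsqrt.trans hΓ
      burst_le := hb
      m_le := hm
      le_m := hnm
      le_sq := (Real.sqrt_le_left (by linarith)).1 hΓ
      log_le := by linarith }

theorem Instance.regime {Ω : Type} (B : Instance n ℓ Γ Ω) : Regime n ℓ #B.RO k Γ := by
  refine regime_of_params hk hkn hℓ hΓ hb ((card_le_univ _).trans_eq (Fintype.card_fin n)) ?_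
  have hunion : #(univ : Finset (Fin n)) ≤ #B.RO + #{t : Fin n | window ℓ t ∈ B.cover} := by
    refine (card_le_card fun t _ => ?_).trans (card_union_le _ _)
    by_cases ht : t ∈ B.RO
    · exact mem_union_left _ ht
    · exact mem_union_right _ (mem_filter.2 ⟨mem_univ _, B.covers t ht⟩)
  rw [card_univ, Fintype.card_fin] at hunion
  have hcovered := card_covered_le (n := n) (ell_pos_of_abs_sub_lt hk hkn hℓ) B.cover
  calc (n : ℝ) ≤ #B.RO + #B.cover * ℓ := by exact_mod_cast hunion.trans (by omega)
    _ ≤ #B.RO + Γ * ℓ := by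
        gcongr
        exact B.card_cover

end Parameters

section ErrorTerms

variable {n ℓ m : ℕ} {k Γ : ℝ}

theorem Regime.error_nonneg (R : Regime n ℓ m k Γ) :
    0 ≤ Γ * ℓ / n * Real.log (n / (Γ * ℓ)) :=
  mul_nonneg (div_nonneg R.burst_pos.le R.n_pos.le) (by linarith [R.log_ge])

theorem Regime.two_div_le (R : Regime n ℓ m k Γ) :
    2 / k ≤ 4 * (Γ * ℓ / n * Real.log (n / (Γ * ℓ))) := by
  have hburst := div_nonneg R.burst_pos.le R.n_pos.le
  calc 2 / k = 2 * (1 / k) := by ring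
    _ ≤ 4 * (Γ * ℓ / n * (1 / 2)) := by linarith [R.inv_le]
    _ ≤ 4 * (Γ * ℓ / n * Real.log (n / (Γ * ℓ))) := by
        gcongr
        exact R.log_ge

variable (hℓ : |(ℓ : ℝ) - n * Real.log k / k| < 1)
include hℓ

theorem Regime.burst_le_log (R : Regime n ℓ m k Γ) :
    Γ * ℓ / n ≤ 2 * (Γ * Real.log k / k) := by
  have hk := R.k_pos
  have hn := R.n_pos
  have hshare := (abs_le.1 (abs_share_sub_log_le hk R.k_le hℓ)).2
  calc Γ * ℓ / n = Γ * share n ℓ k / k := by rw [share]; field_simp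
    _ ≤ Γ * (2 * Real.log k) / k := by
        have := R.Γ_ge
        gcongr
        linarith [three_le_log R.k_ge]
    _ = 2 * (Γ * Real.log k / k) := by ring

theorem Regime.log_burst_le_log (R : Regime n ℓ m k Γ) :
    Real.log (n / (Γ * ℓ)) ≤ 2 * Real.log (k / (Γ * Real.log k)) := by
  have hk := R.k_pos
  have hn := R.n_pos
  have hΓ : 0 < Γ := by linarith [R.Γ_ge]
  have hℓ0 : (0 : ℝ) < ℓ := Nat.cast_pos.2 R.ell_pos
  have hlogk := three_le_log R.k_ge
  have hshare := (abs_le.1 (abs_share_sub_log_le hk R.k_le hℓ)).1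
  have hratio : 5 / 6 * ((n : ℝ) / (Γ * ℓ)) ≤ k / (Γ * Real.log k) := by
    calc 5 / 6 * ((n : ℝ) / (Γ * ℓ)) = k / (Γ * (6 / 5 * share n ℓ k)) := by
          rw [share]; field_simp
      _ ≤ k / (Γ * Real.log k) := by
          gcongr
          linarith
  have hlog := Real.log_le_log (by positivity) hratio
  rw [Real.log_mul (by norm_num) (by positivity)] at hlog
  have hloss := Real.one_sub_inv_le_log_of_pos (x := 5 / 6) (by norm_num)
  norm_num at hloss
  linarith [R.log_ge]

theorem Regime.error_le (R : Regime n ℓ m k Γ) :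
    Γ * ℓ / n * Real.log (n / (Γ * ℓ)) ≤
      4 * (Γ * Real.log k / k * Real.log (k / (Γ * Real.log k))) := by
  have hlog := R.log_ge
  calc Γ * ℓ / n * Real.log (n / (Γ * ℓ))
      ≤ 2 * (Γ * Real.log k / k) * (2 * Real.log (k / (Γ * Real.log k))) := by
        refine mul_le_mul (R.burst_le_log hℓ) (R.log_burst_le_log hℓ) (by linarith) ?_
        exact (div_nonneg R.burst_pos.le R.n_pos.le).trans (R.burst_le_log hℓ)
    _ = _ := by ring

theorem Instance.attains_of_le {Ω : Type} [Fintype Ω] {B : Instance n ℓ Γ Ω}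
    {A : Ω → OnlineAlg n} (R : Regime n ℓ #B.RO k Γ) {C : ℝ} (hC : 0 ≤ C)
    (h : (1 - C * (Γ * ℓ / n * Real.log (n / (Γ * ℓ)))) * B.optRO k ≤ B.expectedValue A) :
    B.Attains A k (4 * C) := by
  have hopt := B.optRO_nonneg k
  have herror := mul_le_mul_of_nonneg_left (R.error_le hℓ) hC
  have hnonneg : 0 ≤ C * (Γ * ℓ / n * Real.log (n / (Γ * ℓ))) :=
    mul_nonneg hC R.error_nonneg
  exact ⟨(mul_le_mul_of_nonneg_right (by linarith) hopt).trans h,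
    (mul_le_mul_of_nonneg_right (by linarith) hopt).trans h⟩

end ErrorTerms

/-! ### Existence of a rule that solves the linear programs -/

section Solver

variable {n ℓ : ℕ} {k Γ : ℝ} {x y : Fin n → Item} {t : Fin n}

theorem isCompact_lpFeasible (x : Fin n → Item) (t : Fin n) :
    IsCompact {X | LPFeasible ℓ k Γ x t X} := by
  have hset : {X | LPFeasible ℓ k Γ x t X} = Set.Icc 0 1 ∩ ({X | ∀ s, t < s → X s = 0} ∩
      ({X | ∑ s ∈ Iic t, (x s).size * X s ≤
        (1 - 4 * Γ * ℓ / ((t : ℝ) + 1)) * (((t : ℝ) + 1) / n) * k} ∩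
      {X | ∀ j : ℕ, ∑ s ∈ Iic t with window ℓ s = j, (x s).size * X s ≤
        601 * (ℓ / n) * k})) := by
    ext X
    exact ⟨fun ⟨h0, h1, hfuture, hbudget, hinner⟩ => ⟨⟨h0, h1⟩, hfuture, hbudget, hinner⟩,
      fun ⟨⟨h0, h1⟩, hfuture, hbudget, hinner⟩ => ⟨h0, h1, hfuture, hbudget, hinner⟩⟩
  rw [hset]
  refine isCompact_Icc.inter_right (IsClosed.inter ?_ (IsClosed.inter ?_ ?_))
  · simp only [Set.ofPred_forall]
    exact isClosed_iInter fun s => isClosed_iInter fun _ =>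
      isClosed_eq (continuous_apply s) continuous_const
  · exact isClosed_le (by fun_prop) continuous_const
  · simp only [Set.ofPred_forall]
    exact isClosed_iInter fun j => isClosed_le (by fun_prop) continuous_const

theorem exists_lpOptimal (h : ∃ X, LPFeasible ℓ k Γ x t X) : ∃ X, LPOptimal ℓ k Γ x t X := by
  have hcont : Continuous fun X : Fin n → ℝ => ∑ s ∈ Iic t, (x s).value * X s := by fun_prop
  obtain ⟨X, hX, hmax⟩ := (isCompact_lpFeasible x t).exists_isMaxOn h hcont.continuousOn
  exact ⟨X, hX, fun Y hY => hmax hY⟩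

theorem LPOptimal.congr (h : ∀ s ≤ t, x s = y s) {X : Fin n → ℝ} (hX : LPOptimal ℓ k Γ x t X) :
    LPOptimal ℓ k Γ y t X := by
  refine ⟨hX.1.congr h, fun Y hY => ?_⟩
  have hval : ∀ Z : Fin n → ℝ, ∑ s ∈ Iic t, (y s).value * Z s = ∑ s ∈ Iic t, (x s).value * Z s :=
    fun Z => sum_congr rfl fun s hs => by rw [h s (mem_Iic.1 hs)]
  rw [hval, hval]
  exact hX.2 Y (hY.congr fun s hs => (h s hs).symm)

/-- Choose an optimal solution for the sequence in which the future items are erased. -/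
theorem nonempty_lpSolver (n ℓ : ℕ) (k Γ : ℝ) : Nonempty (LPSolver n ℓ k Γ) := by
  let past (x : Fin n → Item) (t s : Fin n) : Item := if s ≤ t then x s else ⟨0, 0⟩
  have hpast : ∀ x t, ∀ s ≤ t, past x t s = x s := fun x t s hs => if_pos hs
  have hsolution : ∀ (x : Fin n → Item) (t : Fin n), ∃ X : Fin n → ℝ,
      (∃ Y, LPFeasible ℓ k Γ x t Y) → LPOptimal ℓ k Γ x t X := fun x t => by
    by_cases h : ∃ Y, LPFeasible ℓ k Γ x t Y
    · exact (exists_lpOptimal h).imp fun X hX _ => hX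
    · exact ⟨0, fun hfeas => absurd hfeas h⟩
  choose sol hsol using hsolution
  refine ⟨⟨fun x t => sol (past x t) t, fun x t ⟨Y, hY⟩ => ?_, fun x y t h => ?_⟩⟩
  · exact (hsol _ t ⟨Y, hY.congr fun s hs => (hpast x t s hs).symm⟩).congr (hpast x t)
  · have hxy : past x t = past y t := funext fun s => ite_congr rfl (h s) fun _ => rfl
    exact congrArg (sol · t) hxy

end Solver

/-! ### Breaking ties among densities by random perturbations -/

section ScaledItems

/-- The item `y` with its value multiplied by `c`, except that a worthless item becomes empty: a
positive factor cannot separate the densities of two worthless items of positive size. -/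
def Item.scale (c : ℝ) (y : Item) : Item := if y.value = 0 then ⟨0, 0⟩ else ⟨y.value * c, y.size⟩

variable {y : Item} {c : ℝ}

theorem Item.scale_value (c : ℝ) (y : Item) : (y.scale c).value = y.value * c := by
  unfold Item.scale
  split_ifs with h
  · rw [h, zero_mul]
  · rfl

theorem Item.scale_size (hy : y.value ≠ 0) (c : ℝ) : (y.scale c).size = y.size := by
  rw [Item.scale, if_neg hy]

theorem Item.value_ne_zero_of_scale (h : 0 < (y.scale c).size) : y.value ≠ 0 := by
  intro h0
  rw [Item.scale, if_pos h0] at h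
  exact lt_irrefl _ h

theorem Item.scale_density (hy : y.value ≠ 0) (c : ℝ) :
    (y.scale c).density = y.density * c := by
  rw [Item.density, Item.scale_value, Item.scale_size hy, mul_div_right_comm, Item.density]

theorem Item.Valid.scale (hy : y.Valid) (hc : 0 ≤ c) : (y.scale c).Valid := by
  unfold Item.scale
  split_ifs
  · exact ⟨le_rfl, le_rfl, zero_le_one⟩
  · exact ⟨mul_nonneg hy.1 hc, hy.2⟩

theorem Item.Valid.scale_size_le (hy : y.Valid) (c : ℝ) : (y.scale c).size ≤ y.size := by
  unfold Item.scale
  split_ifs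
  · exact hy.2.1
  · exact le_rfl

end ScaledItems

section ScaledAlgorithms

variable {n : ℕ} {A : OnlineAlg n} {c : Fin n → ℝ} {x : Fin n → Item}

open Classical in
/-- The algorithm that runs `A` after scaling the item at each time `t` by `c t`, and discards the
worthless items selected by `A`, whose sizes are hidden from `A`. -/
def OnlineAlg.scaled (A : OnlineAlg n) (c : Fin n → ℝ) : OnlineAlg n where
  select x := {t ∈ A.select fun t => (x t).scale (c t) | (x t).value ≠ 0}
  online x y t h := by
    rw [mem_filter, mem_filter, h t le_rfl,
      A.online _ (fun t => (y t).scale (c t)) t fun s hs => by rw [h s hs]]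

theorem OnlineAlg.mem_select_scaled {t : Fin n} : t ∈ (A.scaled c).select x ↔
    t ∈ A.select (fun t => (x t).scale (c t)) ∧ (x t).value ≠ 0 :=
  mem_filter

theorem OnlineAlg.Feasible.scaled {k : ℝ} (hA : A.Feasible k) (hc : ∀ t, 0 ≤ c t) :
    (A.scaled c).Feasible k := by
  classical
  intro x hx
  calc ∑ t ∈ (A.scaled c).select x, (x t).size
      = ∑ t ∈ (A.scaled c).select x, ((x t).scale (c t)).size :=
        sum_congr rfl fun t ht => (Item.scale_size (OnlineAlg.mem_select_scaled.1 ht).2 _).symm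
    _ ≤ ∑ t ∈ A.select (fun t => (x t).scale (c t)), ((x t).scale (c t)).size :=
        sum_le_sum_of_subset_of_nonneg (filter_subset _ _) fun t _ _ =>
          ((hx t).scale (hc t)).2.1
    _ ≤ k := hA _ fun t => (hx t).scale (hc t)

theorem OnlineAlg.sum_scaled_value_le {b : ℝ} (hcb : ∀ t, c t ≤ b) (hx : ∀ t, (x t).Valid)
    (F : Finset (Fin n)) :
    ∑ t ∈ F with t ∈ A.select (fun t => (x t).scale (c t)), ((x t).scale (c t)).value ≤
      b * ∑ t ∈ F with t ∈ (A.scaled c).select x, (x t).value := by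
  rw [sum_filter, sum_filter, mul_sum]
  refine sum_le_sum fun t _ => ?_
  by_cases hselect : t ∈ A.select fun t => (x t).scale (c t)
  · by_cases hvalue : (x t).value = 0
    · simp [Item.scale_value, hvalue]
    · rw [if_pos hselect, if_pos (OnlineAlg.mem_select_scaled.2 ⟨hselect, hvalue⟩),
        Item.scale_value, mul_comm]
      exact mul_le_mul_of_nonneg_right (hcb t) (hx t).1
  · rw [if_neg hselect, if_neg fun h => hselect (OnlineAlg.mem_select_scaled.1 h).1, mul_zero]

end ScaledAlgorithms

section Labels

/-- Shifting the label of `s` by a uniform label keeps the labels uniform, and after the labels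
have been fixed at most one shift solves the equation. -/
theorem prob_label_eq_le {α G γ : Type*} [Fintype α] [DecidableEq α] [AddGroup G] [Fintype G]
    {s r : α} (hsr : s ≠ r) {f g : G → γ} (hf : Function.Injective f) :
    prob (fun u : α → G => f (u s) = g (u r)) ≤ 1 / Fintype.card G := by
  classical
  have hshift : ∀ a : G, 𝔼 u : α → G, (if f (u s + a) = g (u r) then (1 : ℝ) else 0) =
      prob fun u : α → G => f (u s) = g (u r) := fun a => by
    refine Fintype.expect_equiv (Equiv.addRight (Pi.single s a)) _ _ fun u => ?_
    simp [hsr.symm]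
  have hcard : ∀ u : α → G, #{a : G | f (u s + a) = g (u r)} ≤ 1 := fun u =>
    card_le_one.2 fun a ha b hb => add_left_cancel <|
      hf ((mem_filter.1 ha).2.trans (mem_filter.1 hb).2.symm)
  calc prob (fun u : α → G => f (u s) = g (u r))
      = 𝔼 a : G, 𝔼 u : α → G, if f (u s + a) = g (u r) then (1 : ℝ) else 0 := by
        rw [expect_congr rfl fun a _ => hshift a, Fintype.expect_const]
    _ = 𝔼 u : α → G, 𝔼 a : G, if f (u s + a) = g (u r) then (1 : ℝ) else 0 := expect_comm ..
    _ ≤ 1 / Fintype.card G := expect_le univ_nonempty fun u _ => by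
        rw [Fintype.expect_eq_sum_div_card, sum_boole]
        exact div_le_div_of_nonneg_right (mod_cast hcard u) (Nat.cast_nonneg _)

variable {M : ℕ}

/-- The factor by which an item with label `a` is scaled. The denominator `M ^ 2` lets the `M`
different factors exceed `1` by at most `1 / M`. -/
def labelFactor (a : Fin M) : ℝ := 1 + a / (M : ℝ) ^ 2

theorem one_le_labelFactor (a : Fin M) : 1 ≤ labelFactor a :=
  le_add_of_nonneg_right (by positivity)

theorem labelFactor_nonneg (a : Fin M) : 0 ≤ labelFactor a :=
  zero_le_one.trans (one_le_labelFactor a)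

theorem labelFactor_le (a : Fin M) : labelFactor a ≤ 1 + 1 / M := by
  have hM : (0 : ℝ) < M := Nat.cast_pos.2 a.pos
  calc labelFactor a ≤ 1 + M / (M : ℝ) ^ 2 := by
        unfold labelFactor
        gcongr
        exact a.isLt.le
    _ = 1 + 1 / M := by field_simp

theorem labelFactor_injective : Function.Injective (labelFactor (M := M)) := by
  intro a b h
  have hM : (M : ℝ) ^ 2 ≠ 0 := pow_ne_zero 2 (Nat.cast_ne_zero.2 a.pos.ne')
  exact Fin.ext (Nat.cast_injective ((div_left_inj' hM).1 (add_left_cancel h)))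

end Labels

namespace Instance

variable {n ℓ M : ℕ} {k Γ : ℝ} {Ω : Type} (B : Instance n ℓ Γ Ω) (e : Ω ≃ (Fin n → Fin M))

/-- The permutation of the times that turns labels of items into labels of times: the `i`-th item
carries the label of the `i`-th random-order time. -/
def relabel (I : {t // t ∈ B.RO} ≃ Fin #B.RO) : Equiv.Perm (Fin n) :=
  Equiv.Perm.ofSubtype (I.trans B.RO.equivFin.symm)

theorem relabel_apply (I : {t // t ∈ B.RO} ≃ Fin #B.RO) (t : {t // t ∈ B.RO}) :
    B.relabel I t = B.RO.equivFin.symm (I t) := by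
  rw [relabel, Equiv.Perm.ofSubtype_apply_of_mem _ t.2]
  rfl

/-- The instance in which the items are scaled according to fixed labels `u`. The labels of the
times are then `u ∘ B.relabel I`, and through `e` they are the internal randomness that the
adversary of `B` observes. -/
def scaled (u : Fin n → Fin M) : Instance n ℓ Γ Unit where
  RO := B.RO
  cover := B.cover
  card_cover := B.card_cover
  covers := B.covers
  item i := (B.item i).scale (labelFactor (u (B.RO.equivFin.symm i)))
  item_valid i := (B.item_valid i).scale (labelFactor_nonneg _)
  adv I _ t := (B.adv I (e.symm (u ∘ B.relabel I)) t).scale (labelFactor (u (B.relabel I t)))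
  adv_valid _ _ _ := (B.adv_valid _ _ _).scale (labelFactor_nonneg _)

theorem scaled_arrival (u : Fin n → Fin M) (I : {t // t ∈ B.RO} ≃ Fin #B.RO) :
    (B.scaled e u).arrival I () = fun t =>
      (B.arrival I (e.symm (u ∘ B.relabel I)) t).scale (labelFactor (u (B.relabel I t))) := by
  funext t
  by_cases ht : t ∈ B.RO
  · have hscaled : (B.scaled e u).arrival I () t = (B.scaled e u).item (I ⟨t, ht⟩) := dif_pos ht
    rw [hscaled, arrival, dif_pos ht, B.relabel_apply I ⟨t, ht⟩]
    rfl
  · have hscaled : (B.scaled e u).arrival I () t = (B.scaled e u).adv I () t := dif_neg ht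
    rw [hscaled, arrival, dif_neg ht]
    rfl

theorem optRO_le_optRO_scaled (hk : 0 ≤ k) (u : Fin n → Fin M) :
    B.optRO k ≤ (B.scaled e u).optRO k := by
  refine B.optRO_le hk fun X hX hXk => ?_
  have hsize : ∑ i, ((B.scaled e u).item i).size * X i ≤ k :=
    (sum_le_sum fun i _ =>
      mul_le_mul_of_nonneg_right ((B.item_valid i).scale_size_le _) (hX i).1).trans hXk
  refine le_trans (sum_le_sum fun i _ => ?_) ((B.scaled e u).le_optRO hX hsize)
  change _ ≤ ((B.item i).scale _).value * X i
  rw [Item.scale_value]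
  exact mul_le_mul_of_nonneg_right
    (le_mul_of_one_le_right (B.item_valid i).1 (one_le_labelFactor _)) (hX i).1

theorem exists_density_eq_of_not_distinct {u : Fin n → Fin M}
    (h : ¬ (B.scaled e u).DistinctDensities) :
    ∃ i j, i ≠ j ∧ 0 < (B.item i).density ∧
      (B.item i).density * labelFactor (u (B.RO.equivFin.symm i)) =
        (B.item j).density * labelFactor (u (B.RO.equivFin.symm j)) := by
  unfold DistinctDensities at h
  push Not at h
  obtain ⟨i, j, hij, hi, hj, heq⟩ := h
  have hvi := Item.value_ne_zero_of_scale hi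
  have hvj := Item.value_ne_zero_of_scale hj
  have hsize : 0 < (B.item i).size := by rwa [← Item.scale_size hvi]
  refine ⟨i, j, hij, div_pos ((B.item_valid i).1.lt_of_ne' hvi) hsize, ?_⟩
  rw [← Item.scale_density hvi, ← Item.scale_density hvj]
  exact heq

theorem prob_density_mul_labelFactor_eq_le [NeZero M] {i j : Fin #B.RO} (hij : i ≠ j)
    (hi : 0 < (B.item i).density) :
    prob (fun u : Fin n → Fin M =>
      (B.item i).density * labelFactor (u (B.RO.equivFin.symm i)) =
        (B.item j).density * labelFactor (u (B.RO.equivFin.symm j))) ≤ 1 / M := by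
  have hinj : Function.Injective fun a : Fin M => (B.item i).density * labelFactor a :=
    fun a b hab => labelFactor_injective (mul_left_cancel₀ hi.ne' hab)
  have htimes : (B.RO.equivFin.symm i : Fin n) ≠ B.RO.equivFin.symm j := fun h =>
    hij (B.RO.equivFin.symm.injective (Subtype.ext h))
  simpa only [Fintype.card_fin] using
    prob_label_eq_le htimes (g := fun a => (B.item j).density * labelFactor a) hinj

theorem prob_not_distinctDensities_scaled_le [NeZero M] :
    prob (fun u : Fin n → Fin M => ¬ (B.scaled e u).DistinctDensities) ≤ (n : ℝ) ^ 2 / M := by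
  classical
  let pairs : Finset (Fin #B.RO × Fin #B.RO) := {ij | ij.1 ≠ ij.2 ∧ 0 < (B.item ij.1).density}
  have hcard : (#pairs : ℝ) ≤ (n : ℝ) ^ 2 := by
    have hRO : #B.RO ≤ n := (card_le_univ B.RO).trans_eq (Fintype.card_fin n)
    have hpairs : #pairs ≤ #B.RO * #B.RO := (card_le_univ _).trans_eq (by simp)
    exact_mod_cast hpairs.trans ((Nat.mul_le_mul hRO hRO).trans_eq (sq n).symm)
  calc prob (fun u : Fin n → Fin M => ¬ (B.scaled e u).DistinctDensities)
      ≤ prob (fun u : Fin n → Fin M => ∃ ij ∈ pairs,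
          (B.item ij.1).density * labelFactor (u (B.RO.equivFin.symm ij.1)) =
            (B.item ij.2).density * labelFactor (u (B.RO.equivFin.symm ij.2))) :=
        prob_mono fun u hu => by
          obtain ⟨i, j, hij, hi, heq⟩ := B.exists_density_eq_of_not_distinct e hu
          exact ⟨(i, j), mem_filter.2 ⟨mem_univ _, hij, hi⟩, heq⟩
    _ ≤ #pairs * (1 / M) := prob_exists_le _ _ fun ij hij =>
        B.prob_density_mul_labelFactor_eq_le (mem_filter.1 hij).2.1 (mem_filter.1 hij).2.2
    _ ≤ (n : ℝ) ^ 2 / M := by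
        rw [mul_one_div]
        gcongr

theorem expectedValue_unit (B : Instance n ℓ Γ Unit) (A : Unit → OnlineAlg n) :
    B.expectedValue A = 𝔼 I : {t // t ∈ B.RO} ≃ Fin #B.RO,
      ∑ t ∈ B.RO with t ∈ (A ()).select (B.arrival I ()), (B.arrival I () t).value :=
  expect_singleton _ _

/-- For a fixed assignment `I`, relabelling is a bijection between the labellings of the items and
those of the times. -/
theorem expectedValue_eq_expect_relabel [Fintype Ω] (A : (Fin n → Fin M) → OnlineAlg n) :
    B.expectedValue (A ∘ e) = 𝔼 u : Fin n → Fin M, 𝔼 I : {t // t ∈ B.RO} ≃ Fin #B.RO,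
      ∑ t ∈ B.RO with t ∈ (A (u ∘ B.relabel I)).select
        (B.arrival I (e.symm (u ∘ B.relabel I))),
        (B.arrival I (e.symm (u ∘ B.relabel I)) t).value := by
  rw [expectedValue, expect_comm, expect_comm (univ : Finset (Fin n → Fin M))]
  refine expect_congr rfl fun I _ => ?_
  refine Fintype.expect_equiv (e.trans ((B.relabel I).arrowCongr (Equiv.refl _))) _ _ fun ω => ?_
  have hlabels : (e.trans ((B.relabel I).arrowCongr (Equiv.refl _))) ω ∘ B.relabel I = e ω := by
    funext t
    simp
  rw [hlabels, Equiv.symm_apply_apply, Function.comp_apply]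

theorem expect_expectedValue_scaled_le [Fintype Ω] (A : OnlineAlg n) :
    𝔼 u : Fin n → Fin M, (B.scaled e u).expectedValue (fun _ => A) ≤
      (1 + 1 / M) * B.expectedValue fun ω => A.scaled fun t => labelFactor (e ω t) := by
  rw [show (fun ω => A.scaled fun t => labelFactor (e ω t)) =
    (fun u : Fin n → Fin M => A.scaled fun t => labelFactor (u t)) ∘ e from rfl,
    expectedValue_eq_expect_relabel, mul_expect]
  refine expect_le_expect fun u _ => ?_
  rw [expectedValue_unit, mul_expect]
  refine expect_le_expect fun I _ => ?_
  rw [B.scaled_arrival e u I]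
  exact OnlineAlg.sum_scaled_value_le (fun t => labelFactor_le _) (B.arrival_valid _ _) _


section Guarantee

variable {A : OnlineAlg n} {q : ℝ} (hq0 : 0 ≤ q)
  (h : ∀ B' : Instance n ℓ Γ Unit, B'.DistinctDensities →
    q * B'.optRO k ≤ B'.expectedValue fun _ => A)
include hq0 h

theorem mul_prob_distinct_le_expect_expectedValue_scaled (hk : 0 ≤ k) :
    q * B.optRO k * prob (fun u : Fin n → Fin M => (B.scaled e u).DistinctDensities) ≤
      𝔼 u : Fin n → Fin M, (B.scaled e u).expectedValue fun _ => A := by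
  rw [prob, mul_expect]
  refine expect_le_expect fun u _ => ?_
  split_ifs with hu
  · rw [mul_one]
    exact (mul_le_mul_of_nonneg_left (B.optRO_le_optRO_scaled e hk u) hq0).trans (h _ hu)
  · rw [mul_zero]
    exact expectedValue_nonneg _ _

/-- The densities become distinct with probability at least `1 - 1 / k`, and the values grow by
factors of at most `1 + 1 / k`. -/
theorem le_expectedValue_scaled [Fintype Ω] (hq1 : q ≤ 1) (hn : 1 ≤ n) (hk : 0 < k)
    (hM : n ^ 2 * k ≤ M) :
    (q - 2 / k) * B.optRO k ≤
      B.expectedValue fun ω => A.scaled fun t => labelFactor (e ω t) := by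
  have hn2 : (1 : ℝ) ≤ (n : ℝ) ^ 2 := one_le_pow₀ (Nat.one_le_cast.2 hn)
  have hM0 : (0 : ℝ) < M := by nlinarith
  have : NeZero M := ⟨Nat.cast_ne_zero.1 hM0.ne'⟩
  have hO := B.optRO_nonneg k
  set E := B.expectedValue fun ω => A.scaled fun t => labelFactor (e ω t)
  have hE : 0 ≤ E := B.expectedValue_nonneg _
  have hcollision : (n : ℝ) ^ 2 / M ≤ 1 / k := by
    rwa [div_le_div_iff₀ hM0 hk, one_mul]
  have hdistinct : 1 - 1 / k ≤
      prob fun u : Fin n → Fin M => (B.scaled e u).DistinctDensities := by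
    refine le_trans ?_ (one_sub_prob_not_le _)
    linarith [B.prob_not_distinctDensities_scaled_le e]
  have hperturbed : q * B.optRO k * (1 - 1 / k) ≤ (1 + 1 / k) * E :=
    calc q * B.optRO k * (1 - 1 / k)
        ≤ q * B.optRO k * prob fun u : Fin n → Fin M => (B.scaled e u).DistinctDensities :=
          mul_le_mul_of_nonneg_left hdistinct (mul_nonneg hq0 hO)
      _ ≤ (1 + 1 / M) * E :=
          (B.mul_prob_distinct_le_expect_expectedValue_scaled e hq0 h hk.le).trans
            (B.expect_expectedValue_scaled_le e A)
      _ ≤ (1 + 1 / k) * E := by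
          have : (1 : ℝ) / M ≤ 1 / k := (div_le_div_of_nonneg_right hn2 hM0.le).trans hcollision
          gcongr
  have hd : 0 < 1 / k := by positivity
  have hratio : (1 + 1 / k) * (q - 2 / k) ≤ q * (1 - 1 / k) := by
    rw [show 2 / k = 2 * (1 / k) by ring]
    nlinarith [mul_nonneg hd.le (sub_nonneg.2 hq1)]
  refine le_of_mul_le_mul_left (le_trans ?_ hperturbed) (by linarith : 0 < 1 + 1 / k)
  rw [← mul_assoc, mul_right_comm q]
  exact mul_le_mul_of_nonneg_right hratio hO

end Guarantee

end Instance

section Randomization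

variable {n ℓ : ℕ} {k Γ : ℝ}

theorem exists_randomized_attains (hk : 80 ≤ k) (hkn : k ≤ (n : ℝ) / 2)
    (hℓ : |(ℓ : ℝ) - n * Real.log k / k| < 1) (hΓ : Real.sqrt k ≤ Γ) (hb : Γ * ℓ / n ≤ 1 / 2)
    {A : OnlineAlg n} (hA : A.Feasible k) {c : ℝ} (hc : 0 ≤ c)
    (h : ∀ B : Instance n ℓ Γ Unit, B.DistinctDensities →
      (1 - c * (Γ * ℓ / n * Real.log (n / (Γ * ℓ)))) * B.optRO k ≤ B.expectedValue fun _ => A) :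
    ∃ N : ℕ, 0 < N ∧ ∃ A' : Fin N → OnlineAlg n, (∀ ω, (A' ω).Feasible k) ∧
      ∀ B : Instance n ℓ Γ (Fin N), B.Attains A' k (4 * (c + 4)) := by
  have hk0 : 0 < k := by linarith
  have hn : 1 ≤ n := Nat.one_le_cast.1 (by linarith : (1 : ℝ) ≤ n)
  have hM : (n : ℝ) ^ 2 * k ≤ ⌈(n : ℝ) ^ 2 * k⌉₊ := Nat.le_ceil _
  set M := ⌈(n : ℝ) ^ 2 * k⌉₊
  have : NeZero M := ⟨(Nat.ceil_pos.2 (by positivity)).ne'⟩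
  let e : Fin (Fintype.card (Fin n → Fin M)) ≃ (Fin n → Fin M) := (Fintype.equivFin _).symm
  refine ⟨_, Fintype.card_pos, fun ω => A.scaled fun t => labelFactor (e ω t),
    fun ω => hA.scaled fun t => labelFactor_nonneg _, fun B => ?_⟩
  have R := B.regime hk hkn hℓ hΓ hb
  refine B.attains_of_le hℓ R (by linarith) ?_
  set ε := Γ * ℓ / n * Real.log (n / (Γ * ℓ))
  have hε : 0 ≤ ε := R.error_nonneg
  have hO := B.optRO_nonneg k
  rcases le_or_gt (1 - c * ε) 0 with hq | hq
  · exact (mul_nonpos_of_nonpos_of_nonneg (by linarith) hO).trans (B.expectedValue_nonneg _)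
  · calc (1 - (c + 4) * ε) * B.optRO k ≤ (1 - c * ε - 2 / k) * B.optRO k :=
          mul_le_mul_of_nonneg_right (by linarith [R.two_div_le]) hO
      _ ≤ _ := B.le_expectedValue_scaled e hq.le h (sub_le_self _ (mul_nonneg hc hε)) hn hk0 hM

end Randomization

end BARO

end

theorem theorem1 :
    ∃ a₀ : ℝ, ∀ a₄ : ℝ, a₀ ≤ a₄ → ∃ C : ℝ, 0 < C ∧
      ∀ (n ℓ : ℕ) (k Γ : ℝ), 80 ≤ k → k ≤ (n : ℝ) / 2 →
        |(ℓ : ℝ) - n * Real.log k / k| < 1 → Real.sqrt k ≤ Γ → Γ * ℓ / n ≤ 1 / 2 →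
        -- the primal algorithm, with an arbitrary rule for choosing optimal solutions
        (∀ S : BARO.LPSolver n ℓ k Γ,
          (BARO.primalAlg a₄ S).Feasible k ∧
          ∀ B : BARO.Instance n ℓ Γ Unit, B.DistinctDensities →
            B.Attains (fun _ => BARO.primalAlg a₄ S) k C) ∧
        -- some randomized online algorithm, with ties among the value densities allowed
        (∃ N : ℕ, 0 < N ∧ ∃ A : Fin N → BARO.OnlineAlg n,
          (∀ ω, (A ω).Feasible k) ∧
          ∀ B : BARO.Instance n ℓ Γ (Fin N), B.Attains A k C) := by
  refine ⟨601, fun a₄ ha => ?_⟩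
  have hc : 0 ≤ BARO.primalConst a₄ := BARO.primalConst_nonneg (by linarith)
  refine ⟨4 * (BARO.primalConst a₄ + 4), by linarith, fun n ℓ k Γ hk hkn hℓ hΓ hb => ?_⟩
  have hratio : ∀ (S : BARO.LPSolver n ℓ k Γ) (B : BARO.Instance n ℓ Γ Unit),
      B.DistinctDensities →
      (1 - BARO.primalConst a₄ * (Γ * ℓ / n * Real.log (n / (Γ * ℓ)))) * B.optRO k ≤
        B.expectedValue fun _ => BARO.primalAlg a₄ S := fun S B hd =>
    B.le_expectedValue_primalAlg (B.regime hk hkn hℓ hΓ hb) hd ha S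
  have hfeasible : ∀ S : BARO.LPSolver n ℓ k Γ, (BARO.primalAlg a₄ S).Feasible k := fun _ =>
    BARO.primalAlg_feasible (by linarith)
  refine ⟨fun S => ⟨hfeasible S, fun B hd => ?_⟩, ?_⟩
  · have R := B.regime hk hkn hℓ hΓ hb
    refine BARO.Instance.attains_of_le hℓ R (by linarith) (le_trans ?_ (hratio S B hd))
    gcongr
    exacts [B.optRO_nonneg k, R.error_nonneg, by linarith]
  · obtain ⟨S⟩ := BARO.nonempty_lpSolver n ℓ k Γ
    exact BARO.exists_randomized_attains hk hkn hℓ hΓ hb (hfeasible S) hc (hratio S)
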